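/- **Definitions.** A *parameterized promise problem* consists of inputs $x$ (encoded as binary words, $|x|$ denoting the length of the encoding), each with a parameter $k\in\mathbb N$, and disjoint sets of YES-inputs and NO-inputs. A *randomized FPT algorithm* for it is a randomized algorithm $\mathcal A$ (a program of a random-access machine with addition, subtraction, indirect addressing and fair coin tosses, each operation costing one unit of time) such that * for some computable function $f$ and some constant $c$, $\mathcal A$ runs in time at most $f(k)\,|x|^{c}$ on every input $x$ with parameter $k$, for every outcome of its coin tosses; * $\Pr[\mathcal A(x)=1]\ge 2/3$ for every YES-input $x$, and $\Pr[\mathcal A(x)=0]\ge 2/3$ for every NO-input $x$. A *2CSP instance* $\Gamma$ consists of a finite simple undirected graph $G=(V,E)$ with $E\neq\emptyset$, a finite non-empty alphabet $\Sigma$, and for each edge $e=(u,v)\in E$ (written in a fixed orientation) a constraint $C_{uv}\subseteq\Sigma\times\Sigma$. It is encoded with $|V|$ and $|\Sigma|$ in unary, the adjacency matrix, and the truth tables of the constraints. The value $\mathrm{val}(\psi)$ of an assignment $\psi:V\to\Sigma$ is the fraction of edges $(u,v)\in E$ with $(\psi(u),\psi(v))\in C_{uv}$, and $\mathrm{val}(\Gamma)=\max_{\psi}\mathrm{val}(\psi)$.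 For $\varepsilon\ge 0$, the problem *$\varepsilon$-Gap 2CSP*, with parameter $|V|$, has the YES-inputs $\Gamma$ with $\mathrm{val}(\Gamma)=1$ and the NO-inputs $\Gamma$ with $\mathrm{val}(\Gamma)<1-\varepsilon$. The *Parameterized Inapproximability Hypothesis (PIH)* states that there exists $\varepsilon>0$ such that there is no randomized FPT algorithm for $\varepsilon$-Gap 2CSP. For a real number $\gamma\ge 1$, the problem *$\gamma$-Gap Maximum Likelihood Decoding* has as inputs a matrix $A\in\mathbb F_2^{n\times m}$, a vector $y\in\mathbb F_2^{n}$ and a positive integer $k$, which is the parameter (encoded with $n,m,k$ in unary, followed by the entries of $A$ and $y$). With $\|x\|_0$ denoting the number of non-zero coordinates of $x$, an input is * a YES-input if there exists $x\in\mathbb F_2^{m}$ with $\|x\|_0\le k$ and $Ax=y$; * a NO-input if $Ax\ne y$ for all $x\in\mathbb F_2^{m}$ with $\|x\|_0\le\gamma k$. **Theorem.** Assuming PIH, for every real $\gamma\ge 1$ there is no randomized FPT algorithm for $\gamma$-Gap Maximum Likelihood Decoding. -/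

import Mathlib

/-! ### Randomized random-access machines with structured control -/

namespace FPT

/-- Programs of a random-access machine.  The machine has registers `R 0, R 1, R 2, …` and a memory
`M 0, M 1, M 2, …`, both holding natural numbers, and can toss fair coins.  A program mentions only
finitely many registers.  The arithmetic operations are addition and truncated subtraction only, so
that the unit-cost measure is polynomially equivalent to the running time of Turing machines. -/
inductive Prog : Type
  /-- `R x := c` -/
  | const (x c : ℕ)
  /-- `R x := R y + R z` -/
  | plus (x y z : ℕ)
  /-- `R x := R y - R z` (truncated at `0`) -/
  | monus (x y z : ℕ)
  /-- `R x := M (R y)` -/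
  | load (x y : ℕ)
  /-- `M (R x) := R y` -/
  | store (x y : ℕ)
  /-- `R x := ` the outcome (`0` or `1`) of a fresh coin toss -/
  | coin (x : ℕ)
  /-- first `p`, then `q` -/
  | seq (p q : Prog)
  /-- if `R x ≠ 0` then `p` else `q` -/
  | cond (x : ℕ) (p q : Prog)
  /-- while `R x ≠ 0` do `p` -/
  | loop (x : ℕ) (p : Prog)

/-- A state of the machine: registers, memory, and the outcomes of the coin tosses still to come. -/
structure State : Type where
  reg : ℕ → ℕ
  mem : ℕ → ℕ
  coins : ℕ → Bool

/-- `Exec p s t s'`: started in state `s`, the program `p` halts after exactly `t` steps in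
state `s'`.  Every elementary instruction and every evaluation of the test of a `cond` or
a `loop` takes one step. -/
inductive Exec : Prog → State → ℕ → State → Prop
  | const (x c : ℕ) (s : State) :
      Exec (Prog.const x c) s 1 { s with reg := Function.update s.reg x c }
  | plus (x y z : ℕ) (s : State) :
      Exec (Prog.plus x y z) s 1 { s with reg := Function.update s.reg x (s.reg y + s.reg z) }
  | monus (x y z : ℕ) (s : State) :
      Exec (Prog.monus x y z) s 1 { s with reg := Function.update s.reg x (s.reg y - s.reg z) }
  | load (x y : ℕ) (s : State) :
      Exec (Prog.load x y) s 1 { s with reg := Function.update s.reg x (s.mem (s.reg y)) }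
  | store (x y : ℕ) (s : State) :
      Exec (Prog.store x y) s 1 { s with mem := Function.update s.mem (s.reg x) (s.reg y) }
  | coin (x : ℕ) (s : State) :
      Exec (Prog.coin x) s 1
        { s with
          reg := Function.update s.reg x (s.coins 0).toNat
          coins := fun i => s.coins (i + 1) }
  | seq {p q : Prog} {s s' s'' : State} {t t' : ℕ} :
      Exec p s t s' → Exec q s' t' s'' → Exec (Prog.seq p q) s (t + t') s''
  | cond_true {x : ℕ} {p q : Prog} {s s' : State} {t : ℕ} :
      s.reg x ≠ 0 → Exec p s t s' → Exec (Prog.cond x p q) s (t + 1) s'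
  | cond_false {x : ℕ} {p q : Prog} {s s' : State} {t : ℕ} :
      s.reg x = 0 → Exec q s t s' → Exec (Prog.cond x p q) s (t + 1) s'
  | loop_exit {x : ℕ} {p : Prog} {s : State} :
      s.reg x = 0 → Exec (Prog.loop x p) s 1 s
  | loop_step {x : ℕ} {p : Prog} {s s' s'' : State} {t t' : ℕ} :
      s.reg x ≠ 0 → Exec p s t s' → Exec (Prog.loop x p) s' t' s'' →
      Exec (Prog.loop x p) s (t + t' + 1) s''

/-- The initial state on the input word `w` with coin tosses `ω`: the bits of `w` are in the memory
cells `0, …, |w| - 1`, register `0` holds `|w|`, and everything else is `0`. -/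
def initState (w : List Bool) (ω : ℕ → Bool) : State where
  reg := fun i => if i = 0 then w.length else 0
  mem := fun i => (w.getD i false).toNat
  coins := ω

/-- On input `w` and coin tosses `ω`, the program `p` halts within `T` steps. -/
def HaltsWithin (p : Prog) (w : List Bool) (ω : ℕ → Bool) (T : ℕ) : Prop :=
  ∃ t s, Exec p (initState w ω) t s ∧ t ≤ T

/-- On input `w` and coin tosses `ω`, the program `p` halts with output `b` (in register `0`). -/
def Outputs (p : Prog) (w : List Bool) (ω : ℕ → Bool) (b : ℕ) : Prop :=
  ∃ t s, Exec p (initState w ω) t s ∧ s.reg 0 = b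

/-- The distribution of an infinite sequence of independent fair coin tosses. -/
noncomputable def coinMeasure : MeasureTheory.Measure (ℕ → Bool) :=
  MeasureTheory.Measure.infinitePi fun _ : ℕ => (PMF.uniformOfFintype Bool).toMeasure

/-! ### Parameterized promise problems and randomized FPT algorithms -/

/-- A parameterized promise problem: a type of inputs, each with its encoding as a binary word
and its parameter, and disjoint sets of YES-inputs and NO-inputs. -/
structure PromiseProblem : Type 1 where
  Input : Type
  encode : Input → List Bool
  param : Input → ℕ
  yes : Set Input
  no : Set Input
  disjoint : Disjoint yes no

/-- `p` is a randomized FPT algorithm for `P`: for some computable `f` and some constant `c` it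
runs in time `f k * |x| ^ c` on every input and for all coin tosses; it outputs `1` with probability
at least `2/3` on each YES-input and outputs `0` with probability at least `2/3` on each
NO-input. -/
def IsRandomizedFPTAlgorithm (P : PromiseProblem) (p : Prog) : Prop :=
  (∃ (f : ℕ → ℕ) (c : ℕ), Computable f ∧
    ∀ (x : P.Input) (ω : ℕ → Bool),
      HaltsWithin p (P.encode x) ω (f (P.param x) * (P.encode x).length ^ c)) ∧
  (∀ x ∈ P.yes, 2 / 3 ≤ coinMeasure {ω | Outputs p (P.encode x) ω 1}) ∧
  (∀ x ∈ P.no, 2 / 3 ≤ coinMeasure {ω | Outputs p (P.encode x) ω 0})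

/-! ### 2CSP -/

/-- An instance of 2CSP on the variables `0, …, n - 1` with alphabet `{0, …, q - 1}`.  An edge
`{u, v}` of the constraint graph is written `(u, v)` with `u < v`, and its constraint is
`constraint u v`; the other values of `constraint` play no role.  There is at least one edge and
the alphabet is non-empty, as the value of an instance would otherwise be undefined. -/
structure CSP : Type where
  n : ℕ
  q : ℕ
  graph : SimpleGraph (Fin n)
  constraint : Fin n → Fin n → Finset (Fin q × Fin q)
  alphabet_nonempty : 0 < q
  exists_edge : ∃ u v, graph.Adj u v

namespace CSP

open Classical in
/-- The edges of the constraint graph, each listed once, with the smaller endpoint first. -/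
noncomputable def edges (Γ : CSP) : Finset (Fin Γ.n × Fin Γ.n) :=
  Finset.univ.filter fun e => e.1 < e.2 ∧ Γ.graph.Adj e.1 e.2

/-- The value of an assignment: the fraction of edges that it satisfies. -/
noncomputable def assignmentValue (Γ : CSP) (ψ : Fin Γ.n → Fin Γ.q) : ℝ :=
  ((Γ.edges.filter fun e => (ψ e.1, ψ e.2) ∈ Γ.constraint e.1 e.2).card : ℝ) / (Γ.edges.card : ℝ)

/-- The value of an instance: the maximum of the values of its assignments. -/
noncomputable def value (Γ : CSP) : ℝ :=
  ⨆ ψ : Fin Γ.n → Fin Γ.q, Γ.assignmentValue ψ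

open Classical in
/-- The encoding of an instance: `n` and `q` in unary, the `n × n` adjacency matrix, and
the `q × q` truth tables of the constraints, everything in lexicographic order. -/
noncomputable def encode (Γ : CSP) : List Bool :=
  List.replicate Γ.n true ++ [false] ++ List.replicate Γ.q true ++ [false] ++
  ((List.finRange Γ.n).flatMap fun u => (List.finRange Γ.n).map fun v =>
    decide (Γ.graph.Adj u v)) ++
  ((List.finRange Γ.n).flatMap fun u => (List.finRange Γ.n).flatMap fun v =>
    (List.finRange Γ.q).flatMap fun a => (List.finRange Γ.q).map fun b =>
      decide ((a, b) ∈ Γ.constraint u v))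

end CSP

/-- `ε`-Gap 2CSP, parameterized by the number of variables. -/
noncomputable def gapCSP (ε : ℝ) (hε : 0 ≤ ε) : PromiseProblem where
  Input := CSP
  encode := CSP.encode
  param := CSP.n
  yes := {Γ | Γ.value = 1}
  no := {Γ | Γ.value < 1 - ε}
  disjoint := Set.disjoint_left.2 fun Γ h h' => by
    change Γ.value = 1 at h
    change Γ.value < 1 - ε at h'
    linarith

/-- The Parameterized Inapproximability Hypothesis. -/
def PIH : Prop :=
  ∃ (ε : ℝ) (hε : 0 < ε), ¬ ∃ p : Prog, IsRandomizedFPTAlgorithm (gapCSP ε hε.le) p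

/-! ### Maximum likelihood decoding -/

/-- An input of the maximum likelihood decoding problem over the field with two elements. -/
structure MLD : Type where
  n : ℕ
  m : ℕ
  A : Matrix (Fin n) (Fin m) (ZMod 2)
  y : Fin n → ZMod 2
  k : ℕ
  k_pos : 0 < k

/-- The encoding of an input: `n`, `m` and `k` in unary, the entries of `A` row by row, and the
entries of `y`.  (As `k` is the parameter, writing it in unary changes a bound of the form
`f k * |x| ^ c` only by a computable function of `k`.) -/
def MLD.encode (I : MLD) : List Bool :=
  List.replicate I.n true ++ [false] ++ List.replicate I.m true ++ [false] ++
  List.replicate I.k true ++ [false] ++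
  ((List.finRange I.n).flatMap fun i => (List.finRange I.m).map fun j => decide (I.A i j = 1)) ++
  ((List.finRange I.n).map fun i => decide (I.y i = 1))

/-- `γ`-Gap Maximum Likelihood Decoding, parameterized by `k`. -/
def gapMLD (γ : ℝ) (hγ : 1 ≤ γ) : PromiseProblem where
  Input := MLD
  encode := MLD.encode
  param := MLD.k
  yes := {I | ∃ x : Fin I.m → ZMod 2, hammingNorm x ≤ I.k ∧ I.A.mulVec x = I.y}
  no := {I | ∀ x : Fin I.m → ZMod 2, (hammingNorm x : ℝ) ≤ γ * I.k → I.A.mulVec x ≠ I.y}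
  disjoint := Set.disjoint_left.2 fun I ⟨x, hx, hy⟩ h => by
    have hk : (hammingNorm x : ℝ) ≤ I.k := by exact_mod_cast hx
    have h0 : (0 : ℝ) ≤ I.k := Nat.cast_nonneg _
    exact h x (hk.trans (by nlinarith)) hy

end FPT

/-!
The proof is a deterministic polynomial-time reduction from 2CSP with a constant gap to maximum
likelihood decoding with a constant gap, followed by repeated squaring of that gap.

*A constant gap.*  A 2CSP instance is turned into a linear system over the field with two elements.
Its unknowns are indexed by an ordered pair of adjacent vertices and a pair of labels for them.  The
equations make forbidden unknowns vanish, identify the two orientations of an edge, require an odd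
number of label pairs on each ordered pair, and require all edges at a vertex to induce the same
labels, counted modulo two, on it.  If `k` is the number of ordered pairs of adjacent vertices,
a satisfying assignment gives a solution of weight `k`.  In a solution of weight at most `(1 + ε) k`
all but at most `ε k` of the ordered pairs have exactly one label pair, and these fit together to an
assignment that satisfies all but a fraction `ε` of the edges (`CSP.toMLD_mem_yes`,
`CSP.toMLD_mem_no`).

*Squaring the gap.*  From `A x = y` one passes to a matrix `X` of unknowns, with equations saying
that `A` maps each row `X j` to a multiple `z j • y` and that the vector `z` of these multiples
satisfies `A z = y`.  A light solution `x` gives `X = x ⊗ x`.  If all solutions of `A x = y` have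
weight more than `γ k`, then more than `γ k` rows of `X` are solutions themselves, so that `X` has
weight more than `(γ k)²` (`MLD.square_mem_yes`, `MLD.square_mem_no`).

*Programs.*  That both maps can be computed by random-access machines in polynomial time is shown
compositionally.  `Evaluable` functions, numbers computed from the input word and some variables,
are closed under arithmetic, access to input bits and bounded sums; `Emittable` lists, written to
the memory behind the input, are closed under concatenation and bounded iteration.  Each closure
lemma carries a polynomial bound along, so that no running time has to be estimated for a particular
program.  Finally, a program for the target problem is run on the written word with its registers
and its memory shifted (`Exec.relocate`, `exists_algorithm_of_reduction`).
-/

namespace FPT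

/-! ### Polynomial bounds -/

theorem one_le_base_pow (N a : ℕ) : 1 ≤ (N + 2) ^ a := Nat.one_le_pow _ _ (by omega)

theorem base_pow_le {a b : ℕ} (N : ℕ) (h : a ≤ b) : (N + 2) ^ a ≤ (N + 2) ^ b :=
  Nat.pow_le_pow_right (by omega) h

/-- A power of two in front of a power of `N + 2` is absorbed by the exponent. -/
theorem two_pow_mul_base_pow_le (N a b : ℕ) : 2 ^ b * (N + 2) ^ a ≤ (N + 2) ^ (a + b) := by
  rw [pow_add, mul_comm]
  exact Nat.mul_le_mul_left _ (Nat.pow_le_pow_left (by omega) _)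

theorem base_pow_add_le (N a b : ℕ) : (N + 2) ^ a + (N + 2) ^ b + 5 ≤ (N + 2) ^ (a + b + 3) := by
  have h := two_pow_mul_base_pow_le N (a + b) 3
  have ha := base_pow_le N (Nat.le_add_right a b)
  have hb := base_pow_le N (Nat.le_add_left b a)
  have := one_le_base_pow N (a + b)
  omega

theorem base_pow_comp_le (N a b : ℕ) :
    (N + (N + 2) ^ a + 2) ^ b ≤ (N + 2) ^ ((a + 2) * b) := by
  rw [pow_mul]
  refine Nat.pow_le_pow_left ?_ _
  have h1 := two_pow_mul_base_pow_le N (a + 1) 1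
  have h2 : (N + 2) ^ (a + 1) = (N + 2) ^ a * (N + 2) := pow_succ _ _
  have h3 := one_le_base_pow N a
  have h4 := Nat.mul_le_mul h3 (le_refl (N + 2))
  have h5 : (N + 2) ^ a * 2 ≤ (N + 2) ^ a * (N + 2) := Nat.mul_le_mul_left _ (by omega)
  rw [show a + 2 = a + 1 + 1 by ring]
  omega

theorem base_pow_loop_le {N a e A K : ℕ} (hA : A ≤ (N + 2) ^ a) (hK : K ≤ (N + 2) ^ e) :
    (N + 2) ^ a + A * (K + 4) + 5 ≤ (N + 2) ^ (a + e + 4) := by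
  have h := two_pow_mul_base_pow_le N (a + e) 4
  have h1 := Nat.mul_le_mul hA hK
  rw [← pow_add] at h1
  have h2 := base_pow_le N (Nat.le_add_right a e)
  have h3 := one_le_base_pow N (a + e)
  rw [mul_add]
  omega

/-! ### Counting loops -/

/-- A loop whose body decreases the counter `c` by one performs as many iterations as the initial
value `n` of the counter; `I j` is an invariant of the states after `j` iterations. -/
theorem exec_loop {c : ℕ} {b : Prog} {n T : ℕ} (I : ℕ → State → Prop)
    (hstep : ∀ j < n, ∀ s, I j s → s.reg c = n - j →
      ∃ t ≤ T, ∃ s', Exec b s t s' ∧ I (j + 1) s' ∧ s'.reg c = n - (j + 1))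
    {s : State} (h0 : I 0 s) (hc : s.reg c = n) :
    ∃ t ≤ n * (T + 1) + 1, ∃ s', Exec (Prog.loop c b) s t s' ∧ I n s' := by
  have key : ∀ d j s, j + d = n → I j s → s.reg c = n - j →
      ∃ t ≤ d * (T + 1) + 1, ∃ s', Exec (Prog.loop c b) s t s' ∧ I n s' := by
    intro d
    induction d with
    | zero =>
      intro j s hj hI hc
      obtain rfl : j = n := by omega
      exact ⟨1, by omega, s, Exec.loop_exit (by omega), hI⟩
    | succ d ih =>
      intro j s hj hI hc
      obtain ⟨t, ht, s', hE, hI', hc'⟩ := hstep j (by omega) s hI hc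
      obtain ⟨t', ht', s'', hE', hI''⟩ := ih (j + 1) s' (by omega) hI' hc'
      refine ⟨t + t' + 1, ?_, s'', Exec.loop_step (by omega) hE hE', hI''⟩
      rw [Nat.succ_mul]
      omega
  exact key n 0 s (by omega) h0 (by omega)

/-! ### Environments -/

/-- A type of environments: tuples of finitely many natural numbers, the values of the variables
that are in scope.  `get x i` is the `i`-th variable, for `i < size`. -/
class Env (α : Type) where
  size : ℕ
  get : α → ℕ → ℕ

instance : Env Unit := ⟨0, fun _ _ => 0⟩

instance {α : Type} [Env α] : Env (α × ℕ) :=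
  ⟨Env.size α + 1, fun x i => if i = Env.size α then x.2 else Env.get x.1 i⟩

section

variable {α : Type} [Env α]

/-- The state `s` holds the input word `w` in its initial place, the values `x` of the variables in
the registers given by `ρ`, and in register `1` an address beyond the input word. -/
structure Holds (ρ : ℕ → ℕ) (w : List Bool) (x : α) (s : State) : Prop where
  len : s.reg 0 = w.length
  ptr : w.length ≤ s.reg 1
  input : ∀ i < w.length, s.mem i = (w.getD i false).toNat
  vars : ∀ i < Env.size α, s.reg (ρ i) = Env.get x i

/-- `N` bounds the length of `w` and the values of the variables. -/
def Bounded (N : ℕ) (w : List Bool) (x : α) : Prop :=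
  w.length ≤ N ∧ ∀ i < Env.size α, Env.get x i ≤ N

/-- Variables are in registers between `2` and `r - 1`. -/
def Located (α : Type) [Env α] (r : ℕ) (ρ : ℕ → ℕ) : Prop :=
  2 ≤ r ∧ ∀ i < Env.size α, 2 ≤ ρ i ∧ ρ i < r

/-- Within `T` steps, `p` puts `v` into register `r` and changes nothing else but higher
registers. -/
def Sets (p : Prog) (s : State) (T r v : ℕ) : Prop :=
  ∃ t ≤ T, ∃ s', Exec p s t s' ∧ s'.reg r = v ∧ (∀ i < r, s'.reg i = s.reg i) ∧
    s'.mem = s.mem ∧ s'.coins = s.coins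

/-- `f` can be computed in polynomial time, from the input word and the variables, wherever the
variables are located, into any register above them. -/
def Evaluable (f : List Bool → α → ℕ) : Prop :=
  ∃ C, ∀ r ρ, Located α r ρ → ∃ p, ∀ w x s N, Holds ρ w x s → Bounded N w x →
    f w x ≤ (N + 2) ^ C ∧ Sets p s ((N + 2) ^ C) r (f w x)

/-- The location function for one more variable, in register `r`. -/
def extendLoc (α : Type) [Env α] (ρ : ℕ → ℕ) (r : ℕ) : ℕ → ℕ :=
  fun i => if i = Env.size α then r else ρ i

theorem Located.mono {r r' : ℕ} {ρ : ℕ → ℕ} (h : Located α r ρ) (hr : r ≤ r') :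
    Located α r' ρ :=
  ⟨h.1.trans hr, fun i hi => ⟨(h.2 i hi).1, (h.2 i hi).2.trans_le hr⟩⟩

theorem Located.extend {r r' r'' : ℕ} {ρ : ℕ → ℕ} (h : Located α r ρ) (hr : r ≤ r')
    (hr' : r' < r'') : Located (α × ℕ) r'' (extendLoc α ρ r') := by
  refine ⟨by have := h.1; omega, fun i hi => ?_⟩
  unfold extendLoc
  split_ifs with hi'
  · exact ⟨h.1.trans hr, hr'⟩
  · have hi : i < Env.size α + 1 := hi
    have := h.2 i (by omega)
    omega

theorem Bounded.extend {N A j : ℕ} {w : List Bool} {x : α} (h : Bounded N w x) (hj : j ≤ A) :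
    Bounded (N + A) w (x, j) := by
  refine ⟨h.1.trans (by omega), fun i hi => ?_⟩
  change (if i = Env.size α then j else Env.get x i) ≤ _
  have hi : i < Env.size α + 1 := hi
  split_ifs with hi'
  · omega
  · have := h.2 i (by omega)
    omega

/-- States that agree on the registers below `r` and on the memory hold the same data. -/
theorem Holds.congr {r : ℕ} {ρ : ℕ → ℕ} {w : List Bool} {x : α} {s s' : State}
    (h : Holds ρ w x s) (hL : Located α r ρ) (hr : ∀ i < r, s'.reg i = s.reg i)
    (hm : s'.mem = s.mem) : Holds ρ w x s' := by
  have h2 := hL.1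
  refine ⟨?_, ?_, ?_, ?_⟩
  · rw [hr 0 (by omega)]; exact h.len
  · rw [hr 1 (by omega)]; exact h.ptr
  · rw [hm]; exact h.input
  · intro i hi
    rw [hr _ (hL.2 i hi).2]; exact h.vars i hi

theorem Holds.extend {ρ : ℕ → ℕ} {w : List Bool} {x : α} {s : State} {r j : ℕ}
    (h : Holds ρ w x s) (hj : s.reg r = j) : Holds (extendLoc α ρ r) w (x, j) s := by
  refine ⟨h.len, h.ptr, h.input, fun i hi => ?_⟩
  change s.reg (if i = Env.size α then r else ρ i) = if i = Env.size α then j else Env.get x i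
  have hi : i < Env.size α + 1 := hi
  split_ifs with hi'
  · exact hj
  · exact h.vars i (by omega)

theorem Holds.weaken {ρ : ℕ → ℕ} {w : List Bool} {y : α × ℕ} {s : State}
    (h : Holds ρ w y s) : Holds ρ w y.1 s := by
  refine ⟨h.len, h.ptr, h.input, fun i hi => ?_⟩
  have := h.vars i (Nat.lt_succ_of_lt hi)
  rw [this]
  exact if_neg hi.ne

theorem Bounded.weaken {N : ℕ} {w : List Bool} {y : α × ℕ} (h : Bounded N w y) :
    Bounded N w y.1 := by
  refine ⟨h.1, fun i hi => ?_⟩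
  have := h.2 i (Nat.lt_succ_of_lt hi)
  rwa [show Env.get y i = Env.get y.1 i from if_neg hi.ne] at this

theorem Located.weaken {r : ℕ} {ρ : ℕ → ℕ} (h : Located (α × ℕ) r ρ) : Located α r ρ :=
  ⟨h.1, fun i hi => h.2 i (Nat.lt_succ_of_lt hi)⟩

/-! ### Polynomial-time evaluation of expressions -/

namespace Evaluable

theorem lit (c : ℕ) : Evaluable fun _ (_ : α) => c := by
  refine ⟨c + 1, fun r ρ hρ => ⟨Prog.const r c, fun w x s N hs hN => ?_⟩⟩
  have hc : c ≤ (N + 2) ^ (c + 1) :=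
    (Nat.lt_pow_self (by omega : 1 < N + 2)).le.trans (base_pow_le N (by omega))
  refine ⟨hc, 1, one_le_base_pow _ _, _, Exec.const _ _ _, ?_, ?_, rfl, rfl⟩
  · simp
  · intro i hi; simp [hi.ne]

theorem length : Evaluable fun w (_ : α) => w.length := by
  refine ⟨1, fun r ρ hρ => ⟨Prog.seq (Prog.const r 0) (Prog.plus r 0 r), fun w x s N hs hN => ?_⟩⟩
  have h2 := hρ.1
  have h3 := hN.1
  rw [pow_one]
  refine ⟨show w.length ≤ _ by omega, 1 + 1, by omega, _, (Exec.const _ _ _).seq (Exec.plus _ _ _ _),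
    ?_, ?_, rfl, rfl⟩
  · simp [hs.len, show (0 : ℕ) ≠ r by omega]
  · intro i hi; simp [hi.ne]

theorem last : Evaluable fun _ (y : α × ℕ) => y.2 := by
  refine ⟨1, fun r ρ hρ =>
    ⟨Prog.seq (Prog.const r 0) (Prog.plus r (ρ (Env.size α)) r), fun w y s N hs hN => ?_⟩⟩
  have h3 := hρ.2 (Env.size α) (Nat.lt_succ_self _)
  have hg : Env.get y (Env.size α) = y.2 := if_pos rfl
  have h4 := hs.vars (Env.size α) (Nat.lt_succ_self _)
  have h5 := hN.2 (Env.size α) (Nat.lt_succ_self _)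
  rw [hg] at h4 h5
  rw [pow_one]
  refine ⟨show y.2 ≤ _ by omega, 1 + 1, by omega, _, (Exec.const _ _ _).seq (Exec.plus _ _ _ _),
    ?_, ?_, rfl, rfl⟩
  · simp [h4, h3.2.ne]
  · intro i hi; simp [hi.ne]

theorem weaken {f : List Bool → α → ℕ} (hf : Evaluable f) :
    Evaluable fun w (y : α × ℕ) => f w y.1 := by
  obtain ⟨C, hC⟩ := hf
  refine ⟨C, fun r ρ hρ => ?_⟩
  obtain ⟨p, hp⟩ := hC r ρ hρ.weaken
  exact ⟨p, fun w y s N hs hN => hp w y.1 s N hs.weaken hN.weaken⟩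

/-- Two values combined by an instruction. -/
theorem binop (op : ℕ → ℕ → ℕ) (ins : ℕ → ℕ → ℕ → Prog)
    (hins : ∀ x y z s, Exec (ins x y z) s 1
      { s with reg := Function.update s.reg x (op (s.reg y) (s.reg z)) })
    (hop : ∀ a b, op a b ≤ a + b) {f g : List Bool → α → ℕ}
    (hf : Evaluable f) (hg : Evaluable g) : Evaluable fun w x => op (f w x) (g w x) := by
  obtain ⟨a, ha⟩ := hf
  obtain ⟨b, hb⟩ := hg
  refine ⟨a + b + 3, fun r ρ hρ => ?_⟩
  obtain ⟨p, hp⟩ := ha r ρ hρ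
  obtain ⟨q, hq⟩ := hb (r + 1) ρ (hρ.mono (by omega))
  refine ⟨(p.seq q).seq (ins r r (r + 1)), fun w x s N hs hN => ?_⟩
  have hle := base_pow_add_le N a b
  obtain ⟨hfb, t, ht, s', hE, hv, hr, hm, hc⟩ := hp w x s N hs hN
  obtain ⟨hgb, t', ht', s'', hE', hv', hr', hm', hc'⟩ := hq w x s' N (hs.congr hρ hr hm) hN
  refine ⟨(hop _ _).trans (by omega), t + t' + 1, by omega, _, (hE.seq hE').seq (hins _ _ _ _),
    ?_, ?_, hm'.trans hm, hc'.trans hc⟩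
  · simp [hv', hr' r (by omega), hv]
  · intro i hi
    simp [hi.ne, hr' i (by omega), hr i hi]

theorem add {f g : List Bool → α → ℕ} (hf : Evaluable f) (hg : Evaluable g) :
    Evaluable fun w x => f w x + g w x :=
  binop (· + ·) Prog.plus Exec.plus (fun _ _ => le_rfl) hf hg

theorem sub {f g : List Bool → α → ℕ} (hf : Evaluable f) (hg : Evaluable g) :
    Evaluable fun w x => f w x - g w x :=
  binop (· - ·) Prog.monus Exec.monus (fun a b => by omega) hf hg

/-- Reading a bit of the input.  The address is compared with the length of the input, as the memory
beyond the input need not be zero. -/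
theorem bit {f : List Bool → α → ℕ} (hf : Evaluable f) :
    Evaluable fun w x => (w.getD (f w x) false).toNat := by
  obtain ⟨a, ha⟩ := hf
  refine ⟨a + 0 + 3, fun r ρ hρ => ?_⟩
  obtain ⟨p, hp⟩ := ha r ρ hρ
  refine ⟨p.seq ((Prog.monus (r + 1) 0 r).seq
    (Prog.cond (r + 1) (Prog.load r r) (Prog.const r 0))), fun w x s N hs hN => ?_⟩
  have hle := base_pow_add_le N a 0
  obtain ⟨hfb, t, ht, s', hE, hv, hr, hm, hc⟩ := hp w x s N hs hN
  refine ⟨(Bool.toNat_le _).trans (one_le_base_pow _ _), ?_⟩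
  have h2 := hρ.1
  have h0 : s'.reg 0 = w.length := by rw [hr 0 (by omega), hs.len]
  by_cases hlt : f w x < w.length
  · refine ⟨t + (1 + (1 + 1)), by omega, _, hE.seq ((Exec.monus _ _ _ _).seq
      (Exec.cond_true ?_ (Exec.load _ _ _))), ?_, ?_, hm, hc⟩
    · simp only [Function.update_self, h0, hv]; omega
    · simp only [Function.update_self]
      rw [Function.update_of_ne (by omega), hv, hm, hs.input _ hlt]
    · intro i hi
      simp [hi.ne, show i ≠ r + 1 by omega, hr i hi]
  · refine ⟨t + (1 + (1 + 1)), by omega, _, hE.seq ((Exec.monus _ _ _ _).seq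
      (Exec.cond_false ?_ (Exec.const _ _ _))), ?_, ?_, hm, hc⟩
    · simp only [Function.update_self, h0, hv]; omega
    · simp [List.getElem?_eq_none (not_lt.1 hlt)]
    · intro i hi
      simp [hi.ne, show i ≠ r + 1 by omega, hr i hi]

theorem sum {f : List Bool → α → ℕ} {g : List Bool → α → ℕ → ℕ} (hf : Evaluable f)
    (hg : Evaluable fun w (y : α × ℕ) => g w y.1 y.2) :
    Evaluable fun w x => ∑ j ∈ Finset.range (f w x), g w x j := by
  obtain ⟨a, ha⟩ := hf
  obtain ⟨b, hb⟩ := hg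
  refine ⟨a + (a + 2) * b + 4, fun r ρ hρ => ?_⟩
  obtain ⟨p, hp⟩ := ha (r + 1) ρ (hρ.mono (by omega))
  obtain ⟨q, hq⟩ := hb (r + 4) (extendLoc α ρ (r + 2)) (hρ.extend (by omega) (by omega))
  -- `r` accumulates the sum, `r + 1` counts down, `r + 2` is the index, `r + 3` holds `1`
  refine ⟨p.seq ((Prog.const r 0).seq ((Prog.const (r + 2) 0).seq ((Prog.const (r + 3) 1).seq
    (Prog.loop (r + 1) (q.seq ((Prog.plus r r (r + 4)).seq ((Prog.plus (r + 2) (r + 2) (r + 3)).seq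
      (Prog.monus (r + 1) (r + 1) (r + 3))))))))), fun w x s N hs hN => ?_⟩
  obtain ⟨hfb, t, ht, s', hE, hv, hr, hm, hc⟩ := hp w x s N hs hN
  set A := f w x with hA
  have hcomp := base_pow_comp_le N a b
  have hle := base_pow_loop_le hfb hcomp
  have hgb : ∀ s, Holds ρ w x s → ∀ j < A, s.reg (r + 2) = j →
      g w x j ≤ (N + (N + 2) ^ a + 2) ^ b ∧
        Sets q s ((N + (N + 2) ^ a + 2) ^ b) (r + 4) (g w x j) :=
    fun s hs j hj hsj => hq w (x, j) s _ (hs.extend hsj) (hN.extend (by omega))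
  have hloop := exec_loop (c := r + 1) (b := q.seq ((Prog.plus r r (r + 4)).seq
      ((Prog.plus (r + 2) (r + 2) (r + 3)).seq (Prog.monus (r + 1) (r + 1) (r + 3)))))
    (n := A) (T := (N + (N + 2) ^ a + 2) ^ b + 3)
    (fun j u => u.reg r = ∑ i ∈ Finset.range j, g w x i ∧ u.reg (r + 2) = j ∧ u.reg (r + 3) = 1 ∧
      (∀ i < r, u.reg i = s.reg i) ∧ u.mem = s.mem ∧ u.coins = s.coins)
    (by
      rintro j hj u ⟨h1, h2, h3, h4, h5, h6⟩ hcnt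
      obtain ⟨-, t₁, ht₁, u', hE₁, hv₁, hr₁, hm₁, hc₁⟩ := hgb u (hs.congr hρ h4 h5) j hj h2
      refine ⟨t₁ + (1 + (1 + 1)), by omega, _, hE₁.seq ((Exec.plus _ _ _ _).seq
        ((Exec.plus _ _ _ _).seq (Exec.monus _ _ _ _))), ⟨?_, ?_, ?_, ?_, hm₁.trans h5,
          hc₁.trans h6⟩, ?_⟩
      · simp [hv₁, hr₁ r (by omega), h1, Finset.sum_range_succ]
      · simp [hr₁ (r + 2) (by omega), hr₁ (r + 3) (by omega), h2, h3]
      · simp [hr₁ (r + 3) (by omega), h3]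
      · intro i hi
        simp [hi.ne, show i ≠ r + 1 by omega, show i ≠ r + 2 by omega, hr₁ i (by omega), h4 i hi]
      · simp [hr₁ (r + 1) (by omega), hr₁ (r + 3) (by omega), hcnt, h3]; omega)
    (s := { s' with reg :=
      Function.update (Function.update (Function.update s'.reg r 0) (r + 2) 0) (r + 3) 1 })
    ⟨by simp, by simp, by simp, fun i hi => by
      simp [hi.ne, show i ≠ r + 2 by omega, show i ≠ r + 3 by omega, hr i (by omega)], hm, hc⟩
    (by simp [hv])
  obtain ⟨t', ht', s'', hE', h1, -, -, h4, h5, h6⟩ := hloop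
  change t' ≤ A * ((N + (N + 2) ^ a + 2) ^ b + 4) + 1 at ht'
  refine ⟨?_, t + (1 + (1 + (1 + t'))), ?_, s'', hE.seq ((Exec.const _ _ _).seq
    ((Exec.const _ _ _).seq ((Exec.const _ _ _).seq hE'))), h1, h4, h5, h6⟩
  · have : ∀ j ∈ Finset.range A, g w x j ≤ (N + (N + 2) ^ a + 2) ^ b := by
      intro j hj
      have hj := Finset.mem_range.1 hj
      refine (hgb { s with reg := Function.update s.reg (r + 2) j } ?_ j hj (by simp)).1
      exact hs.congr hρ (fun i hi => by simp [show i ≠ r + 2 by omega]) rfl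
    have := Finset.sum_le_sum this
    rw [Finset.sum_const, Finset.card_range, smul_eq_mul] at this
    have h7 := Nat.mul_le_mul_left A (Nat.le_add_right ((N + (N + 2) ^ a + 2) ^ b) 4)
    beta_reduce
    rw [← hA]
    omega
  · omega

theorem mul {f g : List Bool → α → ℕ} (hf : Evaluable f) (hg : Evaluable g) :
    Evaluable fun w x => f w x * g w x := by
  simpa using hf.sum (g := fun w x _ => g w x) hg.weaken

end Evaluable

/-! ### Writing the output word -/

/-- The memory `m` after the list `l` has been written to the addresses from `a` on. -/
def writeList (m : ℕ → ℕ) (a : ℕ) (l : List ℕ) : ℕ → ℕ :=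
  fun i => if a ≤ i ∧ i < a + l.length then l.getD (i - a) 0 else m i

theorem writeList_nil (m : ℕ → ℕ) (a : ℕ) : writeList m a [] = m := by
  funext i
  exact if_neg (by simp)

theorem writeList_singleton (m : ℕ → ℕ) (a v : ℕ) :
    writeList m a [v] = Function.update m a v := by
  funext i
  unfold writeList
  by_cases h : i = a
  · subst h; simp
  · rw [if_neg (by simp; omega), Function.update_of_ne h]

theorem writeList_append (m : ℕ → ℕ) (a : ℕ) (l l' : List ℕ) :
    writeList (writeList m a l) (a + l.length) l' = writeList m a (l ++ l') := by
  funext i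
  unfold writeList
  rw [List.length_append]
  by_cases h1 : a + l.length ≤ i ∧ i < a + l.length + l'.length
  · rw [if_pos h1, if_pos (by omega), List.getD_append_right _ _ _ _ (by omega)]
    congr 1; omega
  · rw [if_neg h1]
    by_cases h2 : a ≤ i ∧ i < a + l.length
    · rw [if_pos h2, if_pos (by omega), List.getD_append _ _ _ _ (by omega)]
    · rw [if_neg h2, if_neg (by omega)]

theorem writeList_of_lt {m : ℕ → ℕ} {a i : ℕ} {l : List ℕ} (h : i < a) :
    writeList m a l i = m i :=
  if_neg (by omega)

/-- Within `T` steps, `p` writes `l` to the memory from the address in register `1` on, and advances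
register `1` to the end of what it has written; it changes no other register below `r`. -/
def Writes (p : Prog) (s : State) (T r : ℕ) (l : List ℕ) : Prop :=
  ∃ t ≤ T, ∃ s', Exec p s t s' ∧ s'.reg 1 = s.reg 1 + l.length ∧
    (∀ i < r, i ≠ 1 → s'.reg i = s.reg i) ∧ s'.mem = writeList s.mem (s.reg 1) l ∧
    s'.coins = s.coins

/-- The list `g w x` can be written to the memory in polynomial time. -/
def Emittable (g : List Bool → α → List ℕ) : Prop :=
  ∃ C, ∀ r ρ, Located α r ρ → ∃ p, ∀ w x s N, Holds ρ w x s → Bounded N w x →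
    (g w x).length ≤ (N + 2) ^ C ∧ Writes p s ((N + 2) ^ C) r (g w x)

theorem Holds.congr_of_write {r : ℕ} {ρ : ℕ → ℕ} {w : List Bool} {x : α} {s s' : State}
    {l : List ℕ} (h : Holds ρ w x s) (hL : Located α r ρ) (h1 : s'.reg 1 = s.reg 1 + l.length)
    (hr : ∀ i < r, i ≠ 1 → s'.reg i = s.reg i) (hm : s'.mem = writeList s.mem (s.reg 1) l) :
    Holds ρ w x s' := by
  have h2 := hL.1
  have hp := h.ptr
  refine ⟨?_, ?_, ?_, ?_⟩
  · rw [hr 0 (by omega) (by omega)]; exact h.len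
  · omega
  · intro i hi
    rw [hm, writeList_of_lt (by omega)]; exact h.input i hi
  · intro i hi
    have := hL.2 i hi
    rw [hr _ this.2 (by omega)]; exact h.vars i hi

namespace Emittable

theorem singleton {f : List Bool → α → ℕ} (hf : Evaluable f) :
    Emittable fun w x => [f w x] := by
  obtain ⟨a, ha⟩ := hf
  refine ⟨a + 0 + 3, fun r ρ hρ => ?_⟩
  obtain ⟨p, hp⟩ := ha r ρ hρ
  refine ⟨p.seq ((Prog.store 1 r).seq ((Prog.const r 1).seq (Prog.plus 1 1 r))),
    fun w x s N hs hN => ?_⟩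
  have hle := base_pow_add_le N a 0
  obtain ⟨hfb, t, ht, s', hE, hv, hr, hm, hc⟩ := hp w x s N hs hN
  have h2 := hρ.1
  refine ⟨by simpa using one_le_base_pow N _, t + (1 + (1 + 1)), by omega, _,
    hE.seq ((Exec.store _ _ _).seq ((Exec.const _ _ _).seq (Exec.plus _ _ _ _))), ?_, ?_, ?_, hc⟩
  · simp [show 1 ≠ r by omega, hr 1 (by omega)]
  · intro i hi h1
    simp [h1, hi.ne, hr i hi]
  · simp [hm, hv, hr 1 (by omega), writeList_singleton]

theorem append {g h : List Bool → α → List ℕ} (hg : Emittable g) (hh : Emittable h) :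
    Emittable fun w x => g w x ++ h w x := by
  obtain ⟨a, ha⟩ := hg
  obtain ⟨b, hb⟩ := hh
  refine ⟨a + b + 3, fun r ρ hρ => ?_⟩
  obtain ⟨p, hp⟩ := ha r ρ hρ
  obtain ⟨q, hq⟩ := hb r ρ hρ
  refine ⟨p.seq q, fun w x s N hs hN => ?_⟩
  have hle := base_pow_add_le N a b
  obtain ⟨hfb, t, ht, s', hE, hv, hr, hm, hc⟩ := hp w x s N hs hN
  obtain ⟨hgb, t', ht', s'', hE', hv', hr', hm', hc'⟩ :=
    hq w x s' N (hs.congr_of_write hρ hv hr hm) hN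
  refine ⟨by rw [List.length_append]; omega, t + t', by omega, s'', hE.seq hE', ?_, ?_, ?_,
    hc'.trans hc⟩
  · rw [hv', hv, List.length_append]; omega
  · intro i hi h1
    rw [hr' i hi h1, hr i hi h1]
  · rw [hm', hm, hv, writeList_append]

theorem flatMap {f : List Bool → α → ℕ} {g : List Bool → α → ℕ → List ℕ} (hf : Evaluable f)
    (hg : Emittable fun w (y : α × ℕ) => g w y.1 y.2) :
    Emittable fun w x => (List.range (f w x)).flatMap (g w x) := by
  obtain ⟨a, ha⟩ := hf
  obtain ⟨b, hb⟩ := hg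
  refine ⟨a + (a + 2) * b + 4, fun r ρ hρ => ?_⟩
  obtain ⟨p, hp⟩ := ha r ρ hρ
  obtain ⟨q, hq⟩ := hb (r + 3) (extendLoc α ρ (r + 1)) (hρ.extend (by omega) (by omega))
  -- `r` counts down, `r + 1` is the index, `r + 2` holds `1`
  refine ⟨p.seq ((Prog.const (r + 1) 0).seq ((Prog.const (r + 2) 1).seq
    (Prog.loop r (q.seq ((Prog.plus (r + 1) (r + 1) (r + 2)).seq
      (Prog.monus r r (r + 2))))))), fun w x s N hs hN => ?_⟩
  have h2 := hρ.1
  obtain ⟨hfb, t, ht, s', hE, hv, hr, hm, hc⟩ := hp w x s N hs hN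
  set A := f w x with hA
  have hcomp := base_pow_comp_le N a b
  have hle := base_pow_loop_le hfb hcomp
  have hgb : ∀ s, Holds ρ w x s → ∀ j < A, s.reg (r + 1) = j →
      (g w x j).length ≤ (N + (N + 2) ^ a + 2) ^ b ∧
        Writes q s ((N + (N + 2) ^ a + 2) ^ b) (r + 3) (g w x j) :=
    fun s hs j hj hsj => hq w (x, j) s _ (hs.extend hsj) (hN.extend (by omega))
  have hloop := exec_loop (c := r) (b := q.seq ((Prog.plus (r + 1) (r + 1) (r + 2)).seq
      (Prog.monus r r (r + 2))))
    (n := A) (T := (N + (N + 2) ^ a + 2) ^ b + 3)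
    (fun j u => u.reg 1 = s.reg 1 + ((List.range j).flatMap (g w x)).length ∧ u.reg (r + 1) = j ∧
      u.reg (r + 2) = 1 ∧ (∀ i < r, i ≠ 1 → u.reg i = s.reg i) ∧
      u.mem = writeList s.mem (s.reg 1) ((List.range j).flatMap (g w x)) ∧ u.coins = s.coins)
    (by
      rintro j hj u ⟨h1, h2, h3, h4, h5, h6⟩ hcnt
      obtain ⟨-, t₁, ht₁, u', hE₁, hv₁, hr₁, hm₁, hc₁⟩ :=
        hgb u (hs.congr_of_write hρ h1 h4 h5) j hj h2
      have hsucc : (List.range (j + 1)).flatMap (g w x) =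
          (List.range j).flatMap (g w x) ++ g w x j := by
        rw [List.range_succ, List.flatMap_append, List.flatMap_singleton]
      refine ⟨t₁ + (1 + 1), by omega, _, hE₁.seq
        ((Exec.plus _ _ _ _).seq (Exec.monus _ _ _ _)), ⟨?_, ?_, ?_, ?_, ?_,
          hc₁.trans h6⟩, ?_⟩
      · rw [hsucc, List.length_append]
        simp only [Function.update_apply]
        rw [if_neg (by omega), if_neg (by omega), hv₁, h1]
        omega
      · simp [hr₁ (r + 1) (by omega) (by omega), hr₁ (r + 2) (by omega) (by omega), h2, h3]
      · simp [hr₁ (r + 2) (by omega) (by omega), h3]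
      · intro i hi h1
        simp [hi.ne, show i ≠ r + 1 by omega, hr₁ i (by omega) h1, h4 i hi h1]
      · rw [hsucc, ← writeList_append, ← h1, ← h5]
        exact hm₁
      · simp [hr₁ r (by omega) (by omega), hr₁ (r + 2) (by omega) (by omega), hcnt, h3]; omega)
    (s := { s' with reg := Function.update (Function.update s'.reg (r + 1) 0) (r + 2) 1 })
    ⟨by
      simp only [List.range_zero, List.flatMap_nil, List.length_nil, add_zero]
      rw [Function.update_of_ne (by omega), Function.update_of_ne (by omega), hr 1 (by omega)], by simp, by simp, fun i hi _ => by
      simp [show i ≠ r + 1 by omega, show i ≠ r + 2 by omega, hr i hi],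
      by simp [writeList_nil, hm], hc⟩
    (by simp [hv])
  obtain ⟨t', ht', s'', hE', h1, -, -, h4, h5, h6⟩ := hloop
  change t' ≤ A * ((N + (N + 2) ^ a + 2) ^ b + 4) + 1 at ht'
  refine ⟨?_, t + (1 + (1 + t')), ?_, s'', hE.seq ((Exec.const _ _ _).seq
    ((Exec.const _ _ _).seq hE')), h1, h4, h5, h6⟩
  · have : ∀ j ∈ Finset.range A, (g w x j).length ≤ (N + (N + 2) ^ a + 2) ^ b := by
      intro j hj
      have hj := Finset.mem_range.1 hj
      refine (hgb { s with reg := Function.update s.reg (r + 1) j } ?_ j hj (by simp)).1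
      exact hs.congr hρ (fun i hi => by simp [show i ≠ r + 1 by omega]) rfl
    have := Finset.sum_le_sum this
    rw [Finset.sum_const, Finset.card_range, smul_eq_mul] at this
    have h7 := Nat.mul_le_mul_left A (Nat.le_add_right ((N + (N + 2) ^ a + 2) ^ b) 4)
    have h8 : ((List.range A).flatMap (g w x)).length =
        ∑ j ∈ Finset.range A, (g w x j).length := by
      rw [List.length_flatMap, Finset.sum_range]
      simp [← List.sum_ofFn, List.ofFn_eq_map, ← List.map_coe_finRange_eq_range]
      rfl
    beta_reduce
    rw [← hA]
    omega
  · omega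

end Emittable

end

/-! ### Running a program on a word written by another one -/

/-- A bound for the registers that a program writes to: all of them are below `p.width`. -/
def Prog.width : Prog → ℕ
  | .const x _ => x + 1
  | .plus x _ _ => x + 1
  | .monus x _ _ => x + 1
  | .load x _ => x + 1
  | .store _ _ => 0
  | .coin x => x + 1
  | .seq p q => max p.width q.width
  | .cond _ p q => max p.width q.width
  | .loop _ p => p.width

theorem Exec.reg_eq {p : Prog} {s s' : State} {t : ℕ} (h : Exec p s t s') :
    ∀ i, p.width ≤ i → s'.reg i = s.reg i := by
  induction h with
  | store => exact fun _ _ => rfl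
  | loop_exit => exact fun _ _ => rfl
  | seq _ _ ih ih' =>
    intro i hi
    rw [ih' i ((le_max_right _ _).trans hi), ih i ((le_max_left _ _).trans hi)]
  | cond_true _ _ ih => exact fun i hi => ih i ((le_max_left _ _).trans hi)
  | cond_false _ _ ih => exact fun i hi => ih i ((le_max_right _ _).trans hi)
  | loop_step _ _ _ ih ih' =>
    intro i hi
    rw [ih' i hi, ih i hi]
  | _ =>
    intro i hi
    exact Function.update_of_ne (by simp only [Prog.width] at hi; omega) _ _

/-- The program `p` with its registers moved up by `D`, and its memory moved up by the contents of
register `0`; register `1` is used for computing addresses. -/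
def Prog.relocate (D : ℕ) : Prog → Prog
  | .const x c => .const (x + D) c
  | .plus x y z => .plus (x + D) (y + D) (z + D)
  | .monus x y z => .monus (x + D) (y + D) (z + D)
  | .load x y => .seq (.plus 1 (y + D) 0) (.load (x + D) 1)
  | .store x y => .seq (.plus 1 (x + D) 0) (.store 1 (y + D))
  | .coin x => .coin (x + D)
  | .seq p q => .seq (p.relocate D) (q.relocate D)
  | .cond x p q => .cond (x + D) (p.relocate D) (q.relocate D)
  | .loop x p => .loop (x + D) (p.relocate D)

/-- The state `u` contains a copy of the state `s`, with registers moved up by `D` and memory moved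
up by `B`. -/
structure Simulates (D B : ℕ) (s u : State) : Prop where
  base : u.reg 0 = B
  reg : ∀ i, u.reg (i + D) = s.reg i
  mem : ∀ i, u.mem (i + B) = s.mem i
  coins : u.coins = s.coins

theorem Simulates.update_reg {D B : ℕ} (hD : 2 ≤ D) {s u : State} (h : Simulates D B s u)
    {x v v' : ℕ} (hv : v' = v) {c c' : ℕ → Bool} (hc : c' = c) :
    Simulates D B { s with reg := Function.update s.reg x v, coins := c }
      { u with reg := Function.update u.reg (x + D) v', coins := c' } := by
  subst hv
  refine ⟨?_, fun i => ?_, h.mem, hc⟩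
  · simp [show 0 ≠ x + D by omega, h.base]
  · by_cases hi : i = x
    · subst hi; simp
    · simp [hi, h.reg i]

theorem Simulates.update_scratch {D B : ℕ} (hD : 2 ≤ D) {s u : State} (h : Simulates D B s u)
    {v : ℕ} : Simulates D B s { u with reg := Function.update u.reg 1 v } := by
  refine ⟨?_, fun i => ?_, h.mem, h.coins⟩
  · simp [h.base]
  · simp [show i + D ≠ 1 by omega, h.reg i]

theorem Simulates.update_mem {D B : ℕ} {s u : State} (h : Simulates D B s u) {a v : ℕ} :
    Simulates D B { s with mem := Function.update s.mem a v }
      { u with mem := Function.update u.mem (a + B) v } := by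
  refine ⟨h.base, h.reg, fun i => ?_, h.coins⟩
  by_cases hi : i = a
  · subst hi; simp
  · simp [hi, h.mem i]

theorem Exec.relocate {D B : ℕ} (hD : 2 ≤ D) {p : Prog} {s s' : State} {t : ℕ}
    (h : Exec p s t s') : ∀ u, Simulates D B s u →
      ∃ t' ≤ 2 * t, ∃ u', Exec (p.relocate D) u t' u' ∧ Simulates D B s' u' := by
  induction h with
  | const x c s => exact fun u hu => ⟨1, by omega, _, Exec.const _ _ _, hu.update_reg hD rfl hu.coins⟩
  | plus x y z s =>
    exact fun u hu => ⟨1, by omega, _, Exec.plus _ _ _ _,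
      hu.update_reg hD (by rw [hu.reg, hu.reg]) hu.coins⟩
  | monus x y z s =>
    exact fun u hu => ⟨1, by omega, _, Exec.monus _ _ _ _,
      hu.update_reg hD (by rw [hu.reg, hu.reg]) hu.coins⟩
  | load x y s =>
    intro u hu
    refine ⟨1 + 1, by omega, _, (Exec.plus _ _ _ _).seq (Exec.load _ _ _),
      (hu.update_scratch hD).update_reg hD ?_ hu.coins⟩
    simp [hu.reg, hu.base, hu.mem]
  | store x y s =>
    intro u hu
    refine ⟨1 + 1, by omega, _, (Exec.plus _ _ _ _).seq (Exec.store _ _ _), ?_⟩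
    have := (hu.update_scratch hD (v := u.reg (x + D) + u.reg 0)).update_mem
      (a := s.reg x) (v := s.reg y)
    simpa [hu.reg, hu.base, show y + D ≠ 1 by omega] using this
  | coin x s =>
    intro u hu
    refine ⟨1, by omega, _, Exec.coin _ _, ?_⟩
    rw [hu.coins]
    exact hu.update_reg hD rfl rfl
  | seq _ _ ih ih' =>
    intro u hu
    obtain ⟨t, ht, u', hE, hu'⟩ := ih u hu
    obtain ⟨t', ht', u'', hE', hu''⟩ := ih' u' hu'
    exact ⟨t + t', by omega, u'', hE.seq hE', hu''⟩
  | cond_true hx _ ih =>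
    intro u hu
    obtain ⟨t, ht, u', hE, hu'⟩ := ih u hu
    exact ⟨t + 1, by omega, u', Exec.cond_true (by rwa [hu.reg]) hE, hu'⟩
  | cond_false hx _ ih =>
    intro u hu
    obtain ⟨t, ht, u', hE, hu'⟩ := ih u hu
    exact ⟨t + 1, by omega, u', Exec.cond_false (by rwa [hu.reg]) hE, hu'⟩
  | loop_exit hx =>
    exact fun u hu => ⟨1, by omega, u, Exec.loop_exit (by rwa [hu.reg]), hu⟩
  | loop_step hx _ _ ih ih' =>
    intro u hu
    obtain ⟨t, ht, u', hE, hu'⟩ := ih u hu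
    obtain ⟨t', ht', u'', hE', hu''⟩ := ih' u' hu'
    exact ⟨t + t' + 1, by omega, u'', Exec.loop_step (by rwa [hu.reg]) hE hE', hu''⟩

/-- If the list `g w` can be written in polynomial time, then any program can be run on the word
`g w` instead of `w` with a polynomial overhead. -/
theorem Emittable.exists_prog {g : List Bool → Unit → List ℕ} (hg : Emittable g) (p : Prog) :
    ∃ (C : ℕ) (p' : Prog), ∀ w v : List Bool, g w () = v.map Bool.toNat →
      v.length ≤ (w.length + 2) ^ C ∧
      ∀ ω t s, Exec p (initState v ω) t s → ∃ t' ≤ (w.length + 2) ^ C + 2 * t + 5, ∃ s',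
        Exec p' (initState w ω) t' s' ∧ s'.reg 0 = s.reg 0 := by
  obtain ⟨C, hC⟩ := hg
  obtain ⟨e, he⟩ := hC 2 (fun _ => 0) ⟨le_rfl, fun i hi => absurd hi (Nat.not_lt_zero i)⟩
  set D := max 2 e.width with hDdef
  have hD : 2 ≤ D := le_max_left _ _
  have hDe : e.width ≤ D := le_max_right _ _
  refine ⟨C, (Prog.plus 1 0 1).seq (e.seq ((Prog.monus D 1 0).seq ((p.relocate D).seq
    ((Prog.const 1 0).seq (Prog.plus 0 D 1))))), fun w v hv => ?_⟩
  have key : ∀ ω, (g w ()).length ≤ (w.length + 2) ^ C ∧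
      Writes e { initState w ω with reg := Function.update (initState w ω).reg 1 w.length }
        ((w.length + 2) ^ C) 2 (g w ()) := fun ω => by
    refine he w () _ w.length ⟨?_, ?_, ?_, ?_⟩ ⟨le_rfl, fun i hi => absurd hi (Nat.not_lt_zero i)⟩
    · simp [initState]
    · simp
    · exact fun i hi => rfl
    · exact fun i hi => absurd hi (Nat.not_lt_zero i)
  refine ⟨by simpa [hv] using (key fun _ => false).1, fun ω t s hE => ?_⟩
  obtain ⟨-, t₁, ht₁, u, hu, h1, h2, h3, h4⟩ := key ω
  have hreg := hu.reg_eq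
  have h0 : u.reg 0 = w.length := by
    rw [h2 0 (by omega) (by omega)]
    simp [initState]
  have h1 : u.reg 1 = w.length + v.length := by
    rw [h1, hv]; simp
  have hsim : Simulates D w.length (initState v ω)
      { u with reg := Function.update u.reg D (u.reg 1 - u.reg 0) } := by
    refine ⟨?_, fun i => ?_, fun i => ?_, ?_⟩
    · simp [show (0 : ℕ) ≠ D by omega, h0]
    · by_cases hi : i = 0
      · subst hi; simp [h0, h1, initState]
      · simp only [initState, if_neg hi]
        rw [Function.update_of_ne (by omega), hreg _ (by omega)]
        simp [initState, show i + D ≠ 1 by omega, hi]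
    · simp only [h3, Function.update_self, hv, writeList, List.length_map, initState]
      split_ifs with hi
      · rw [show i + w.length - w.length = i by omega, ← Bool.toNat_false, List.getD_map]
      · rw [List.getD_eq_default _ _ (by omega), List.getD_eq_default _ _ (by omega)]
    · exact h4
  obtain ⟨t₂, ht₂, u', hE', hu'⟩ := hE.relocate hD _ hsim
  refine ⟨1 + (t₁ + (1 + (t₂ + (1 + 1)))), by omega, _, Exec.seq (Exec.plus _ _ _ _) (Exec.seq ?_
    (Exec.seq (Exec.monus _ _ _ _) (Exec.seq hE' (Exec.seq (Exec.const _ _ _)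
      (Exec.plus _ _ _ _))))), ?_⟩
  · convert hu using 3
    simp [initState]
  · have := hu'.reg 0
    rw [zero_add] at this
    simp [show D ≠ 1 by omega, this]

theorem computable_sum_range_sq {f : ℕ → ℕ} (hf : Computable f) :
    Computable fun k => 2 * (∑ i ∈ Finset.range (k ^ 2 + 1), f i) + 6 := by
  have hsum : Computable fun n => ∑ i ∈ Finset.range n, f i := by
    have h : Computable fun n : ℕ =>
        (Nat.rec 0 (fun i r => r + f i) n : ℕ) := by
      refine Computable.nat_rec (f := id) (g := fun _ => 0) (h := fun _ (q : ℕ × ℕ) => q.2 + f q.1)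
        Computable.id (Computable.const 0) ?_
      exact (Primrec.nat_add.to_comp.comp
        (Computable.snd.comp Computable.snd)
        (hf.comp (Computable.fst.comp Computable.snd)))
    refine h.of_eq fun n => ?_
    induction n with
    | zero => rfl
    | succ n ih => rw [Finset.sum_range_succ, ← ih]
  have hsq : Computable fun k : ℕ => k ^ 2 + 1 := by
    refine Primrec.to_comp ?_
    simp only [sq]
    exact Primrec.succ.comp (Primrec.nat_mul.comp Primrec.id Primrec.id)
  exact Primrec.nat_add.to_comp.comp
    (Primrec.nat_mul.to_comp.comp (Computable.const 2) (hsum.comp hsq)) (Computable.const 6)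

/-- The reduction principle: a map between inputs whose encoding can be written in polynomial time,
that preserves YES-inputs and NO-inputs and at most squares the parameter, transports randomized FPT
algorithms backwards. -/
theorem exists_algorithm_of_reduction {P Q : PromiseProblem} (R : P.Input → Q.Input)
    {g : List Bool → Unit → List ℕ} (hg : Emittable g)
    (henc : ∀ x, g (P.encode x) () = (Q.encode (R x)).map Bool.toNat)
    (hlen : ∀ x, 2 ≤ (P.encode x).length)
    (hparam : ∀ x, Q.param (R x) ≤ P.param x ^ 2)
    (hyes : ∀ x ∈ P.yes, R x ∈ Q.yes) (hno : ∀ x ∈ P.no, R x ∈ Q.no)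
    (hQ : ∃ p, IsRandomizedFPTAlgorithm Q p) : ∃ p, IsRandomizedFPTAlgorithm P p := by
  obtain ⟨p, ⟨f, c, hf, htime⟩, hpyes, hpno⟩ := hQ
  obtain ⟨C, p', hp'⟩ := hg.exists_prog p
  have hout : ∀ x b, {ω | Outputs p (Q.encode (R x)) ω b} ⊆ {ω | Outputs p' (P.encode x) ω b} := by
    rintro x b ω ⟨t, s, hE, hb⟩
    obtain ⟨t', -, s', hE', hb'⟩ := (hp' _ _ (henc x)).2 ω t s hE
    exact ⟨t', s', hE', hb'.trans hb⟩
  refine ⟨p', ⟨_, 2 * C * (c + 1), computable_sum_range_sq hf, fun x ω => ?_⟩,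
    fun x hx => (hpyes _ (hyes x hx)).trans (MeasureTheory.measure_mono (hout x 1)),
    fun x hx => (hpno _ (hno x hx)).trans (MeasureTheory.measure_mono (hout x 0))⟩
  obtain ⟨t, s, hE, ht⟩ := htime (R x) ω
  obtain ⟨hL, hrun⟩ := hp' _ _ (henc x)
  obtain ⟨t', ht', s', hE', -⟩ := hrun ω t s hE
  refine ⟨t', s', hE', ht'.trans ?_⟩
  set N := (P.encode x).length
  have hN : 2 ≤ N := hlen x
  have hpoly : (N + 2) ^ C ≤ N ^ (2 * C) := by
    rw [pow_mul]
    exact Nat.pow_le_pow_left (by nlinarith) _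
  have h1 : N ^ (2 * C) ≤ N ^ (2 * C * (c + 1)) :=
    Nat.pow_le_pow_right (by omega) (Nat.le_mul_of_pos_right _ (by omega))
  have h2 : (Q.encode (R x)).length ^ c ≤ N ^ (2 * C * (c + 1)) := by
    refine (Nat.pow_le_pow_left (hL.trans hpoly) c).trans ?_
    rw [← pow_mul]
    exact Nat.pow_le_pow_right (by omega) (Nat.mul_le_mul_left _ (by omega))
  have h3 : f (Q.param (R x)) ≤ ∑ i ∈ Finset.range (P.param x ^ 2 + 1), f i :=
    Finset.single_le_sum (f := f) (fun _ _ => Nat.zero_le _)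
      (Finset.mem_range.2 (Nat.lt_succ_of_le (hparam x)))
  have h4 := Nat.mul_le_mul h3 h2
  have h5 : 1 ≤ N ^ (2 * C * (c + 1)) := Nat.one_le_pow _ _ (by omega)
  rw [add_mul, mul_assoc]
  omega

/-! ### Linear systems with structured index sets -/

/-- A type with a fixed listing of its elements. -/
class Enumerated (α : Type) where
  card : ℕ
  equiv : Fin card ≃ α

/-- The elements of an enumerated type, in order. -/
def enumList (α : Type) [Enumerated α] : List α :=
  (List.finRange (Enumerated.card α)).map Enumerated.equiv

instance (n : ℕ) : Enumerated (Fin n) := ⟨n, Equiv.refl _⟩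

instance {α β : Type} [Enumerated α] [Enumerated β] : Enumerated (α × β) :=
  ⟨Enumerated.card α * Enumerated.card β,
    finProdFinEquiv.symm.trans (Equiv.prodCongr Enumerated.equiv Enumerated.equiv)⟩

instance {α β : Type} [Enumerated α] [Enumerated β] : Enumerated (α ⊕ β) :=
  ⟨Enumerated.card α + Enumerated.card β,
    finSumFinEquiv.symm.trans (Equiv.sumCongr Enumerated.equiv Enumerated.equiv)⟩

theorem enumList_fin (n : ℕ) : enumList (Fin n) = List.finRange n :=
  List.map_id _

theorem enumList_sum (α β : Type) [Enumerated α] [Enumerated β] :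
    enumList (α ⊕ β) = (enumList α).map Sum.inl ++ (enumList β).map Sum.inr := by
  have h : ∀ a b : ℕ, List.finRange (a + b) =
      (List.finRange a).map (Fin.castAdd b) ++ (List.finRange b).map (Fin.natAdd a) := by
    intro a b
    rw [← List.ofFn_eq_map, ← List.ofFn_eq_map, ← List.ofFn_id, List.ofFn_add]
    rfl
  change (List.finRange (Enumerated.card α + Enumerated.card β)).map
    (finSumFinEquiv.symm.trans (Equiv.sumCongr Enumerated.equiv Enumerated.equiv)) = _
  rw [h, List.map_append, enumList, enumList]
  simp [List.map_map, Function.comp_def]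

theorem enumList_prod (α β : Type) [Enumerated α] [Enumerated β] :
    enumList (α × β) = (enumList α).flatMap fun a => (enumList β).map fun b => (a, b) := by
  have h : ∀ a b : ℕ, List.finRange (a * b) = (List.finRange a).flatMap fun i =>
      (List.finRange b).map fun j => finProdFinEquiv (i, j) := by
    intro a b
    rw [← List.ofFn_id, List.ofFn_mul, List.flatMap_def, ← List.ofFn_eq_map]
    congr 2
    funext i
    rw [← List.ofFn_eq_map]
    congr 1
    funext j
    ext
    simp [finProdFinEquiv, mul_comm]
    ring
  change (List.finRange (Enumerated.card α * Enumerated.card β)).map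
    (finProdFinEquiv.symm.trans (Equiv.prodCongr Enumerated.equiv Enumerated.equiv)) = _
  rw [h, List.map_flatMap, enumList, enumList, List.flatMap_map]
  simp only [List.map_map, Function.comp_def, Equiv.trans_apply, Equiv.symm_apply_apply]
  rfl

section

variable {R C : Type} [Enumerated R] [Enumerated C]

/-- The decoding instance of a linear system whose equations and unknowns are indexed by enumerated
types. -/
def MLD.ofSystem (A : R → C → ZMod 2) (y : R → ZMod 2) (k : ℕ) (hk : 0 < k) : MLD where
  n := Enumerated.card R
  m := Enumerated.card C
  A := Matrix.of fun i j => A (Enumerated.equiv i) (Enumerated.equiv j)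
  y := fun i => y (Enumerated.equiv i)
  k := k
  k_pos := hk

theorem toNat_decide_eq_one (a : ZMod 2) : (decide (a = 1)).toNat = a.val := by
  revert a; decide

theorem MLD.encode_ofSystem (A : R → C → ZMod 2) (y : R → ZMod 2) (k : ℕ) (hk : 0 < k) :
    (MLD.ofSystem A y k hk).encode.map Bool.toNat =
      List.replicate (Enumerated.card R) 1 ++ [0] ++ List.replicate (Enumerated.card C) 1 ++ [0] ++
      List.replicate k 1 ++ [0] ++
      ((enumList R).flatMap fun r => (enumList C).map fun c => (A r c).val) ++
      (enumList R).map fun r => (y r).val := by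
  simp only [MLD.encode, List.map_append, List.map_replicate, List.map_flatMap, List.map_map,
    Function.comp_def, toNat_decide_eq_one]
  simp [MLD.ofSystem, enumList, List.flatMap_map]
  rfl

theorem hammingNorm_comp_equiv {ι κ : Type} [Fintype ι] [Fintype κ] (e : ι ≃ κ)
    (x : κ → ZMod 2) : hammingNorm (fun i => x (e i)) = hammingNorm x :=
  Finset.card_equiv e (by simp)

theorem mulVec_equiv_eq_iff [Fintype C] (A : R → C → ZMod 2) (y : R → ZMod 2) (x : C → ZMod 2) :
    (Matrix.of fun i j => A (Enumerated.equiv i) (Enumerated.equiv j)).mulVec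
      (fun i => x (Enumerated.equiv i)) = (fun i => y (Enumerated.equiv i)) ↔
    ∀ r, ∑ c, A r c * x c = y r := by
  rw [funext_iff, (Enumerated.equiv (α := R)).forall_congr_left]
  refine forall_congr' fun r => ?_
  simp only [Matrix.mulVec, dotProduct, Matrix.of_apply, Equiv.apply_symm_apply]
  rw [Equiv.sum_comp Enumerated.equiv fun c => A r c * x c]

theorem MLD.exists_solution_ofSystem [Fintype C] (A : R → C → ZMod 2) (y : R → ZMod 2) (k : ℕ)
    (hk : 0 < k) (p : ℕ → Prop) :
    (∃ x : Fin (MLD.ofSystem A y k hk).m → ZMod 2, p (hammingNorm x) ∧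
      (MLD.ofSystem A y k hk).A.mulVec x = (MLD.ofSystem A y k hk).y) ↔
    ∃ x : C → ZMod 2, p (hammingNorm x) ∧ ∀ r, ∑ c, A r c * x c = y r := by
  change (∃ x : Fin (Enumerated.card C) → ZMod 2, p (hammingNorm x) ∧
    (Matrix.of fun i j => A (Enumerated.equiv i) (Enumerated.equiv j)).mulVec x =
      fun i => y (Enumerated.equiv i)) ↔ _
  rw [(Equiv.arrowCongr Enumerated.equiv (Equiv.refl (ZMod 2))).symm.surjective.exists]
  refine exists_congr fun x => and_congr ?_ (mulVec_equiv_eq_iff A y x)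
  change p (hammingNorm fun i => x (Enumerated.equiv i)) ↔ _
  rw [hammingNorm_comp_equiv]

theorem MLD.ofSystem_mem_yes [Fintype C] {A : R → C → ZMod 2} {y : R → ZMod 2} {k : ℕ}
    {hk : 0 < k} {γ : ℝ} {hγ : 1 ≤ γ} (x : C → ZMod 2) (hx : hammingNorm x ≤ k)
    (h : ∀ r, ∑ c, A r c * x c = y r) : MLD.ofSystem A y k hk ∈ (gapMLD γ hγ).yes :=
  (MLD.exists_solution_ofSystem A y k hk (· ≤ k)).2 ⟨x, hx, h⟩

theorem MLD.ofSystem_mem_no [Fintype C] {A : R → C → ZMod 2} {y : R → ZMod 2} {k : ℕ}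
    {hk : 0 < k} {γ : ℝ} {hγ : 1 ≤ γ}
    (h : ∀ x : C → ZMod 2, (hammingNorm x : ℝ) ≤ γ * k → ¬ ∀ r, ∑ c, A r c * x c = y r) :
    MLD.ofSystem A y k hk ∈ (gapMLD γ hγ).no := by
  intro x hx hxy
  obtain ⟨x', hx', h'⟩ :=
    (MLD.exists_solution_ofSystem A y k hk (fun n => (n : ℝ) ≤ γ * k)).1 ⟨x, hx, hxy⟩
  exact h x' hx' h'

end

theorem hammingNorm_prod {ι κ : Type} [Fintype ι] [Fintype κ] (x : ι × κ → ZMod 2) :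
    hammingNorm x = ∑ i, hammingNorm fun j => x (i, j) := by
  simp only [hammingNorm, Finset.card_filter, Fintype.sum_prod_type]

/-! ### Squaring the gap -/

/-- The equality of two indices as an element of the field with two elements. -/
def ind {n : ℕ} (i j : Fin n) : ZMod 2 := if i = j then 1 else 0

namespace MLD

/-- The matrix of the squared instance.  The unknowns form a matrix `X` with rows `X j`.  Equations
of the first kind say that all vectors `A (X j)` are multiples of `y`; those of the second kind say
that `∑ j, A r j • A (X j) = y r • y`. -/
def squareMatrix (I : MLD) :
    (Fin I.m × Fin I.n × Fin I.n) ⊕ (Fin I.n × Fin I.n) → Fin I.m × Fin I.m → ZMod 2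
  | .inl (j, i, i'), (j', l) => ind j j' * (I.y i * I.A i' l + I.y i' * I.A i l)
  | .inr (r, i), (j, l) => I.A r j * I.A i l

/-- The right-hand side of the squared instance. -/
def squareVector (I : MLD) : (Fin I.m × Fin I.n × Fin I.n) ⊕ (Fin I.n × Fin I.n) → ZMod 2
  | .inl _ => 0
  | .inr (r, i) => I.y r * I.y i

/-- The composition of a decoding instance with itself. -/
def square (I : MLD) : MLD :=
  ofSystem I.squareMatrix I.squareVector (I.k * I.k) (Nat.mul_pos I.k_pos I.k_pos)

theorem sum_squareMatrix_inl (I : MLD) (X : Fin I.m × Fin I.m → ZMod 2) (j : Fin I.m)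
    (i i' : Fin I.n) : ∑ c, I.squareMatrix (.inl (j, i, i')) c * X c =
      I.y i * I.A.mulVec (fun l => X (j, l)) i' + I.y i' * I.A.mulVec (fun l => X (j, l)) i := by
  rw [Fintype.sum_prod_type, Finset.sum_eq_single j]
  · simp only [squareMatrix, ind, Matrix.mulVec, dotProduct, Finset.mul_sum,
      ← Finset.sum_add_distrib, if_true]
    exact Finset.sum_congr rfl fun l _ => by ring
  · intro j' _ hj
    exact Finset.sum_eq_zero fun l _ => by simp [squareMatrix, ind, hj.symm]
  · simp

theorem sum_squareMatrix_inr (I : MLD) (X : Fin I.m × Fin I.m → ZMod 2) (r i : Fin I.n) :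
    ∑ c, I.squareMatrix (.inr (r, i)) c * X c =
      ∑ j, I.A r j * I.A.mulVec (fun l => X (j, l)) i := by
  rw [Fintype.sum_prod_type]
  simp only [squareMatrix, Matrix.mulVec, dotProduct, Finset.mul_sum, mul_assoc]

theorem square_mem_yes {I : MLD} {γ γ' : ℝ} {hγ : 1 ≤ γ} {hγ' : 1 ≤ γ'}
    (h : I ∈ (gapMLD γ hγ).yes) : I.square ∈ (gapMLD γ' hγ').yes := by
  obtain ⟨x, hx, hxy⟩ := h
  have hrow : ∀ j, I.A.mulVec (fun l => x j * x l) = fun i => x j * I.y i := by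
    intro j
    rw [← hxy]
    exact Matrix.mulVec_smul _ (x j) x
  refine ofSystem_mem_yes (fun c => x c.1 * x c.2) ?_ ?_
  · have : (Finset.univ.filter fun c : Fin I.m × Fin I.m => x c.1 * x c.2 ≠ 0) =
        (Finset.univ.filter fun i => x i ≠ 0) ×ˢ (Finset.univ.filter fun i => x i ≠ 0) := by
      ext c; simp
    rw [hammingNorm, this, Finset.card_product]
    exact Nat.mul_le_mul hx hx
  · rintro (⟨j, i, i'⟩ | ⟨r, i⟩)
    · rw [sum_squareMatrix_inl]
      simp only [hrow, squareVector]
      rw [show I.y i * (x j * I.y i') = I.y i' * (x j * I.y i) by ring]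
      exact CharTwo.add_self_eq_zero _
    · rw [sum_squareMatrix_inr]
      simp only [hrow, squareVector, ← mul_assoc, ← Finset.sum_mul]
      rw [← hxy]
      rfl

theorem square_mem_no {I : MLD} {γ : ℝ} {hγ : 1 ≤ γ} {hγ' : 1 ≤ γ ^ 2}
    (h : I ∈ (gapMLD γ hγ).no) : I.square ∈ (gapMLD (γ ^ 2) hγ').no := by
  have hk : (0 : ℝ) < γ * I.k := mul_pos (by linarith) (Nat.cast_pos.2 I.k_pos)
  refine ofSystem_mem_no fun X hX hsol => ?_
  -- if `y` were zero, the zero vector would be a solution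
  obtain ⟨i₀, hi₀⟩ : ∃ i₀, I.y i₀ = 1 := by
    by_contra hy
    refine h 0 (by simpa using hk.le) ?_
    funext i
    rw [Matrix.mulVec_zero]
    have h01 : ∀ a : ZMod 2, a ≠ 1 → 0 = a := by decide
    exact h01 _ fun hi => hy ⟨i, hi⟩
  set z : Fin I.m → ZMod 2 := fun j => I.A.mulVec (fun l => X (j, l)) i₀ with hz
  have hrow : ∀ j i, I.A.mulVec (fun l => X (j, l)) i = I.y i * z j := by
    intro j i
    have := hsol (.inl (j, i₀, i))
    rw [sum_squareMatrix_inl, hi₀, one_mul] at this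
    exact CharTwo.add_eq_zero.1 this
  have hzsol : I.A.mulVec z = I.y := by
    funext r
    have := hsol (.inr (r, i₀))
    rw [sum_squareMatrix_inr, squareVector, hi₀, mul_one] at this
    exact this
  have hzk : γ * I.k < hammingNorm z := by
    by_contra hle
    exact h z (not_lt.1 hle) hzsol
  have hXk : ∀ j, z j ≠ 0 → γ * I.k ≤ hammingNorm fun l => X (j, l) := by
    intro j hj
    by_contra hle
    refine h _ (not_le.1 hle).le ?_
    funext i
    have h01 : ∀ a : ZMod 2, a ≠ 0 → a = 1 := by decide
    rw [hrow, h01 _ hj, mul_one]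
  have hsum : (hammingNorm z : ℝ) * (γ * I.k) ≤ hammingNorm X := by
    rw [hammingNorm_prod X, Nat.cast_sum, hammingNorm, ← nsmul_eq_mul, ← Finset.sum_const]
    refine (Finset.sum_le_sum fun j hj => hXk j (Finset.mem_filter.1 hj).2).trans ?_
    exact Finset.sum_le_sum_of_subset_of_nonneg (Finset.filter_subset _ _)
      fun _ _ _ => Nat.cast_nonneg _
  have := mul_lt_mul_of_pos_right hzk hk
  push_cast at hX
  nlinarith

end MLD

/-! ### From 2CSP to decoding with a constant gap -/

namespace CSP

open Classical in
/-- The adjacency relation as an element of the field with two elements. -/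
noncomputable def adjInd (Γ : CSP) (u v : Fin Γ.n) : ZMod 2 := if Γ.graph.Adj u v then 1 else 0

/-- The pair of labels `(s, t)` is allowed on the ordered pair of adjacent vertices `(u, v)`, in
either orientation of the edge. -/
def Allowed (Γ : CSP) (u v : Fin Γ.n) (s t : Fin Γ.q) : Prop :=
  Γ.graph.Adj u v ∧ if u < v then (s, t) ∈ Γ.constraint u v else (t, s) ∈ Γ.constraint v u

open Classical in
/-- `Allowed` as an element of the field with two elements. -/
noncomputable def allowedInd (Γ : CSP) (u v : Fin Γ.n) (s t : Fin Γ.q) : ZMod 2 :=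
  if Γ.Allowed u v s t then 1 else 0

/-- The matrix of the decoding instance.  The unknown `x (u, v, s, t)` says that the ordered pair of
adjacent vertices `(u, v)` gets the labels `(s, t)`.  Equations of the first kind say that unknowns
which are not allowed vanish and that the others are symmetric, those of the second kind that
the number of pairs of labels chosen for `(u, v)` is odd if `u` and `v` are adjacent, and those of
the third kind that the labels induced on `u` by the edges `(u, v)` and `(u, v')` agree. -/
noncomputable def systemMatrix (Γ : CSP) :
    (Fin Γ.n × Fin Γ.n × Fin Γ.q × Fin Γ.q) ⊕ (Fin Γ.n × Fin Γ.n) ⊕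
      (Fin Γ.n × Fin Γ.n × Fin Γ.n × Fin Γ.q) → Fin Γ.n × Fin Γ.n × Fin Γ.q × Fin Γ.q → ZMod 2
  | .inl (u, v, s, t), (a, b, c, d) =>
      ind u a * ind v b * ind s c * ind t d +
        Γ.allowedInd u v s t * (ind u b * ind v a * ind s d * ind t c)
  | .inr (.inl (u, v)), (a, b, _, _) => ind u a * ind v b
  | .inr (.inr (u, v, v', s)), (a, b, c, _) =>
      Γ.adjInd u v * Γ.adjInd u v' * (ind u a * ind s c) * (ind v b + ind v' b)

/-- The right-hand side of the decoding instance. -/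
noncomputable def systemVector (Γ : CSP) :
    (Fin Γ.n × Fin Γ.n × Fin Γ.q × Fin Γ.q) ⊕ (Fin Γ.n × Fin Γ.n) ⊕
      (Fin Γ.n × Fin Γ.n × Fin Γ.n × Fin Γ.q) → ZMod 2
  | .inl _ => 0
  | .inr (.inl (u, v)) => Γ.adjInd u v
  | .inr (.inr _) => 0

open Classical in
/-- The ordered pairs of adjacent vertices. -/
noncomputable def darts (Γ : CSP) : Finset (Fin Γ.n × Fin Γ.n) :=
  Finset.univ.filter fun e => Γ.graph.Adj e.1 e.2

theorem mem_darts {Γ : CSP} {e : Fin Γ.n × Fin Γ.n} : e ∈ Γ.darts ↔ Γ.graph.Adj e.1 e.2 := by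
  simp [darts]

theorem mem_edges {Γ : CSP} {e : Fin Γ.n × Fin Γ.n} :
    e ∈ Γ.edges ↔ e.1 < e.2 ∧ Γ.graph.Adj e.1 e.2 := by
  simp [edges]

theorem card_darts_pos (Γ : CSP) : 0 < Γ.darts.card := by
  obtain ⟨u, v, h⟩ := Γ.exists_edge
  exact Finset.card_pos.2 ⟨(u, v), mem_darts.2 h⟩

/-- The decoding instance of a 2CSP instance. -/
noncomputable def toMLD (Γ : CSP) : MLD :=
  MLD.ofSystem Γ.systemMatrix Γ.systemVector Γ.darts.card Γ.card_darts_pos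

theorem Allowed.symm {Γ : CSP} {u v : Fin Γ.n} {s t : Fin Γ.q} (h : Γ.Allowed u v s t) :
    Γ.Allowed v u t s := by
  refine ⟨h.1.symm, ?_⟩
  have h2 := h.2
  have hne := h.1.ne
  rcases lt_or_gt_of_ne hne with hlt | hlt
  · rw [if_pos hlt] at h2
    rwa [if_neg hlt.asymm]
  · rw [if_neg hlt.asymm] at h2
    rwa [if_pos hlt]

theorem sum_ind_mul {n : ℕ} (a : Fin n) (f : Fin n → ZMod 2) : ∑ b, ind a b * f b = f a := by
  simp [ind]

variable (Γ : CSP) (x : Fin Γ.n × Fin Γ.n × Fin Γ.q × Fin Γ.q → ZMod 2)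

theorem sum_systemMatrix_symmetry (u v : Fin Γ.n) (s t : Fin Γ.q) :
    ∑ c, Γ.systemMatrix (.inl (u, v, s, t)) c * x c =
      x (u, v, s, t) + Γ.allowedInd u v s t * x (v, u, t, s) := by
  have h1 : ∑ c : Fin Γ.n × Fin Γ.n × Fin Γ.q × Fin Γ.q,
      ind u c.1 * (ind v c.2.1 * (ind s c.2.2.1 * (ind t c.2.2.2 * x c))) = x (u, v, s, t) := by
    simp only [Fintype.sum_prod_type, ← Finset.mul_sum, sum_ind_mul]
  have h2 : ∑ c : Fin Γ.n × Fin Γ.n × Fin Γ.q × Fin Γ.q,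
      ind v c.1 * (ind u c.2.1 * (ind t c.2.2.1 * (ind s c.2.2.2 * x c))) = x (v, u, t, s) := by
    simp only [Fintype.sum_prod_type, ← Finset.mul_sum, sum_ind_mul]
  rw [← h1, ← h2, Finset.mul_sum, ← Finset.sum_add_distrib]
  refine Finset.sum_congr rfl fun ⟨a, b, c, d⟩ _ => ?_
  simp only [systemMatrix]
  ring

theorem sum_systemMatrix_block (u v : Fin Γ.n) :
    ∑ c, Γ.systemMatrix (.inr (.inl (u, v))) c * x c = ∑ c : Fin Γ.q × Fin Γ.q, x (u, v, c) := by
  simp only [Fintype.sum_prod_type, systemMatrix, mul_assoc, ← Finset.mul_sum, sum_ind_mul]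

theorem sum_systemMatrix_consistency (u v v' : Fin Γ.n) (s : Fin Γ.q) :
    ∑ c, Γ.systemMatrix (.inr (.inr (u, v, v', s))) c * x c =
      Γ.adjInd u v * Γ.adjInd u v' * (∑ t, x (u, v, s, t) + ∑ t, x (u, v', s, t)) := by
  have h : ∀ v : Fin Γ.n, ∑ c : Fin Γ.n × Fin Γ.n × Fin Γ.q × Fin Γ.q,
      ind u c.1 * (ind v c.2.1 * (ind s c.2.2.1 * x c)) = ∑ t, x (u, v, s, t) := fun v => by
    simp only [Fintype.sum_prod_type, ← Finset.mul_sum, sum_ind_mul]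
  rw [← h v, ← h v', ← Finset.sum_add_distrib, Finset.mul_sum]
  refine Finset.sum_congr rfl fun ⟨a, b, c, d⟩ _ => ?_
  simp only [systemMatrix]
  ring

variable {Γ x}

theorem toMLD_mem_yes {γ : ℝ} {hγ : 1 ≤ γ} (h : Γ.value = 1) :
    Γ.toMLD ∈ (gapMLD γ hγ).yes := by
  classical
  have hq : Nonempty (Fin Γ.q) := ⟨⟨0, Γ.alphabet_nonempty⟩⟩
  obtain ⟨ψ, hψ⟩ : ∃ ψ, Γ.assignmentValue ψ = Γ.value := exists_eq_ciSup_of_finite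
  rw [h, assignmentValue] at hψ
  have hne : (Γ.edges.card : ℝ) ≠ 0 := by
    intro h0
    rw [h0, div_zero] at hψ
    exact zero_ne_one hψ
  rw [div_eq_one_iff_eq hne, Nat.cast_inj, Finset.card_filter_eq_iff] at hψ
  have hall : ∀ u v, Γ.graph.Adj u v → Γ.Allowed u v (ψ u) (ψ v) := by
    have hlt : ∀ u v, u < v → Γ.graph.Adj u v → Γ.Allowed u v (ψ u) (ψ v) := fun u v huv hadj =>
      ⟨hadj, by rw [if_pos huv]; exact hψ (u, v) (mem_edges.2 ⟨huv, hadj⟩)⟩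
    intro u v hadj
    rcases lt_or_gt_of_ne hadj.ne with huv | huv
    · exact hlt u v huv hadj
    · exact (hlt v u huv hadj.symm).symm
  set x : Fin Γ.n × Fin Γ.n × Fin Γ.q × Fin Γ.q → ZMod 2 := fun c =>
    Γ.adjInd c.1 c.2.1 * (ind (ψ c.1) c.2.2.1 * ind (ψ c.2.1) c.2.2.2) with hx
  have hmarg : ∀ u v s, ∑ t, x (u, v, s, t) = Γ.adjInd u v * ind (ψ u) s := by
    intro u v s
    simp only [hx, ← Finset.mul_sum, ← mul_assoc]
    simp [ind]
  refine MLD.ofSystem_mem_yes x ?_ ?_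
  · have hsub : (Finset.univ.filter fun c => x c ≠ 0) ⊆
        Γ.darts.image fun e => (e.1, e.2, ψ e.1, ψ e.2) := by
      rintro ⟨u, v, s, t⟩ hc
      simp only [hx, Finset.mem_filter, ind, adjInd, mul_ne_zero_iff, ite_ne_right_iff] at hc
      obtain ⟨-, ⟨h1, -⟩, ⟨rfl, -⟩, ⟨rfl, -⟩⟩ := hc
      exact Finset.mem_image.2 ⟨(u, v), mem_darts.2 h1, rfl⟩
    exact (Finset.card_le_card hsub).trans Finset.card_image_le
  · rintro (⟨u, v, s, t⟩ | ⟨u, v⟩ | ⟨u, v, v', s⟩)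
    · rw [sum_systemMatrix_symmetry, systemVector]
      have hsymm : x (v, u, t, s) = x (u, v, s, t) := by
        simp only [hx, adjInd, Γ.graph.adj_comm v u]
        ring
      rw [hsymm]
      by_cases hc : x (u, v, s, t) = 0
      · rw [hc]; simp
      · have hc' := hc
        simp only [hx, ind, adjInd, mul_ne_zero_iff, ite_ne_right_iff, ne_eq] at hc'
        obtain ⟨⟨h1, -⟩, ⟨rfl, -⟩, ⟨rfl, -⟩⟩ := hc'
        rw [allowedInd, if_pos (hall u v h1), one_mul]
        exact CharTwo.add_self_eq_zero _
    · rw [sum_systemMatrix_block, Fintype.sum_prod_type]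
      simp only [hmarg, ← Finset.mul_sum, systemVector]
      simp [ind]
    · rw [sum_systemMatrix_consistency, hmarg, hmarg, systemVector, adjInd, adjInd]
      split_ifs <;> simp [CharTwo.add_self_eq_zero]

theorem card_darts_le : Γ.darts.card ≤ 2 * Γ.edges.card := by
  classical
  have hsub : Γ.darts ⊆ Γ.edges ∪ Γ.edges.image Prod.swap := by
    rintro ⟨u, v⟩ he
    have hadj := mem_darts.1 he
    rw [Finset.mem_union]
    rcases lt_or_gt_of_ne hadj.ne with huv | huv
    · exact Or.inl (mem_edges.2 ⟨huv, hadj⟩)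
    · exact Or.inr (Finset.mem_image.2 ⟨(v, u), mem_edges.2 ⟨huv, hadj.symm⟩, rfl⟩)
  have h1 := Finset.card_le_card hsub
  have h2 := Finset.card_union_le Γ.edges (Γ.edges.image Prod.swap)
  have h3 : (Γ.edges.image Prod.swap).card ≤ _ := Finset.card_image_le
  omega

/-- A solution of weight at most `(1 + ε) k` selects exactly one pair of labels on all but `ε k`
darts; the labels of these darts fit together to an assignment. -/
theorem toMLD_mem_no {ε : ℝ} (hε : 0 < ε) {hγ : 1 ≤ 1 + ε} (h : Γ.value < 1 - ε) :
    Γ.toMLD ∈ (gapMLD (1 + ε) hγ).no := by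
  classical
  refine MLD.ofSystem_mem_no fun x hx hsol => ?_
  have hall : ∀ {u v s t}, x (u, v, s, t) ≠ 0 → Γ.Allowed u v s t := by
    intro u v s t hc
    have := hsol (.inl (u, v, s, t))
    rw [sum_systemMatrix_symmetry, systemVector, allowedInd] at this
    by_contra hA
    rw [if_neg hA, zero_mul, add_zero] at this
    exact hc this
  have hsymm : ∀ {u v s t}, x (u, v, s, t) ≠ 0 → x (v, u, t, s) ≠ 0 := by
    intro u v s t hc h0
    have := hsol (.inl (u, v, s, t))
    rw [sum_systemMatrix_symmetry, systemVector, h0, mul_zero, add_zero] at this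
    exact hc this
  have hcons : ∀ {u v v'} s, Γ.graph.Adj u v → Γ.graph.Adj u v' →
      ∑ t, x (u, v, s, t) = ∑ t, x (u, v', s, t) := by
    intro u v v' s h1 h2
    have := hsol (.inr (.inr (u, v, v', s)))
    rw [sum_systemMatrix_consistency, systemVector, adjInd, adjInd, if_pos h1, if_pos h2, one_mul,
      one_mul] at this
    exact CharTwo.add_eq_zero.1 this
  -- the number of pairs of labels selected on each dart
  set cnt : Fin Γ.n × Fin Γ.n → ℕ := fun e => hammingNorm fun c => x (e.1, e.2, c) with hcnt
  have hpos : ∀ e ∈ Γ.darts, 1 ≤ cnt e := by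
    intro e he
    have := hsol (.inr (.inl e))
    rw [sum_systemMatrix_block, systemVector, adjInd, if_pos (mem_darts.1 he)] at this
    refine Nat.one_le_iff_ne_zero.2 fun h0 => ?_
    have h0 := fun c => congrFun (hammingNorm_eq_zero.1 h0) c
    simp [h0] at this
  have hsum : hammingNorm x = ∑ e, cnt e := by
    rw [hammingNorm_prod, Fintype.sum_prod_type]
    exact Finset.sum_congr rfl fun u _ => hammingNorm_prod _
  -- a dart on which a single pair of labels is selected
  have hsingle : ∀ {u v}, cnt (u, v) = 1 → ∃ s t, x (u, v, s, t) ≠ 0 ∧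
      ∀ s' t', x (u, v, s', t') ≠ 0 → s' = s ∧ t' = t := by
    intro u v h1
    obtain ⟨⟨s, t⟩, hst⟩ := Finset.card_eq_one.1 h1
    refine ⟨s, t, ?_, fun s' t' h' => ?_⟩
    · have : (s, t) ∈ ({(s, t)} : Finset (Fin Γ.q × Fin Γ.q)) := Finset.mem_singleton_self _
      rw [← hst] at this
      exact (Finset.mem_filter.1 this).2
    · have : (s', t') ∈ ({(s, t)} : Finset (Fin Γ.q × Fin Γ.q)) := by
        rw [← hst]
        exact Finset.mem_filter.2 ⟨Finset.mem_univ _, h'⟩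
      simpa using this
  have hmarg : ∀ {u v s t}, cnt (u, v) = 1 → x (u, v, s, t) ≠ 0 →
      ∀ s', ∑ t', x (u, v, s', t') ≠ 0 ↔ s' = s := by
    intro u v s t h1 hst s'
    obtain ⟨s₀, t₀, -, huniq⟩ := hsingle h1
    obtain ⟨rfl, rfl⟩ := huniq s t hst
    constructor
    · intro hne
      obtain ⟨t', -, ht'⟩ := Finset.exists_ne_zero_of_sum_ne_zero hne
      exact (huniq _ _ ht').1
    · rintro rfl
      rw [Finset.sum_eq_single t]
      · exact hst
      · intro t' _ ht'
        by_contra hne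
        exact ht' (huniq _ _ hne).2
      · simp
  have hψ : ∃ ψ : Fin Γ.n → Fin Γ.q, ∀ u v s t, cnt (u, v) = 1 → x (u, v, s, t) ≠ 0 →
      s = ψ u := by
    have : ∀ u, ∃ a : Fin Γ.q, ∀ v s t, cnt (u, v) = 1 → x (u, v, s, t) ≠ 0 → s = a := by
      intro u
      by_cases hu : ∃ v s t, cnt (u, v) = 1 ∧ x (u, v, s, t) ≠ 0
      · obtain ⟨v₀, s₀, t₀, h1, h2⟩ := hu
        refine ⟨s₀, fun v s t h1' h2' => ?_⟩
        have := hcons s (hall h2').1 (hall h2).1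
        rw [← hmarg h1 h2, ← this, hmarg h1' h2']
      · exact ⟨⟨0, Γ.alphabet_nonempty⟩, fun v s t h1 h2 => absurd ⟨v, s, t, h1, h2⟩ hu⟩
    choose ψ hψ using this
    exact ⟨ψ, hψ⟩
  obtain ⟨ψ, hψ⟩ := hψ
  have hcswap : ∀ u v, cnt (u, v) = cnt (v, u) := by
    intro u v
    refine Finset.card_equiv (Equiv.prodComm _ _) fun c => ?_
    simp only [Finset.mem_filter, Finset.mem_univ, true_and]
    exact ⟨hsymm, hsymm⟩
  set bad := Γ.darts.filter fun e => cnt e ≠ 1 with hbad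
  have hgood : ∀ u v, Γ.graph.Adj u v → (u, v) ∉ bad → Γ.Allowed u v (ψ u) (ψ v) := by
    intro u v hadj hb
    have h1 : cnt (u, v) = 1 := by
      by_contra hne
      exact hb (Finset.mem_filter.2 ⟨mem_darts.2 hadj, hne⟩)
    obtain ⟨s, t, hst, -⟩ := hsingle h1
    rw [← hψ u v s t h1 hst, ← hψ v u t s (hcswap u v ▸ h1) (hsymm hst)]
    exact hall hst
  have hbadcard : (bad.card : ℝ) ≤ ε * Γ.darts.card := by
    have h1 : Γ.darts.card + bad.card ≤ hammingNorm x := by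
      rw [hsum, hbad, Finset.card_filter, Finset.card_eq_sum_ones, ← Finset.sum_add_distrib]
      refine (Finset.sum_le_sum fun e he => ?_).trans
        (Finset.sum_le_sum_of_subset (Finset.subset_univ Γ.darts))
      have := hpos e he
      split_ifs <;> omega
    have h2 : (Γ.darts.card : ℝ) + bad.card ≤ hammingNorm x := by exact_mod_cast h1
    linarith
  set unsat := Γ.edges.filter fun e => (ψ e.1, ψ e.2) ∉ Γ.constraint e.1 e.2 with hunsat
  have hunsatcard : 2 * unsat.card ≤ bad.card := by
    have hnot : ∀ e ∈ unsat, e.1 < e.2 ∧ Γ.graph.Adj e.1 e.2 ∧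
        ¬ Γ.Allowed e.1 e.2 (ψ e.1) (ψ e.2) := by
      intro e he
      obtain ⟨he, hn⟩ := Finset.mem_filter.1 he
      obtain ⟨hlt, hadj⟩ := mem_edges.1 he
      refine ⟨hlt, hadj, fun hA => hn ?_⟩
      have := hA.2
      rwa [if_pos hlt] at this
    have hdisj : Disjoint unsat (unsat.image Prod.swap) := by
      rw [Finset.disjoint_left]
      rintro e he he'
      obtain ⟨e', he'', rfl⟩ := Finset.mem_image.1 he'
      exact (hnot _ he).1.asymm (hnot _ he'').1
    have hsub : unsat ∪ unsat.image Prod.swap ⊆ bad := by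
      refine Finset.union_subset (fun e he => ?_) fun e he => ?_
      · obtain ⟨-, hadj, hA⟩ := hnot e he
        by_contra hb
        exact hA (hgood _ _ hadj hb)
      · obtain ⟨e', he', rfl⟩ := Finset.mem_image.1 he
        obtain ⟨-, hadj, hA⟩ := hnot e' he'
        by_contra hb
        exact hA (hgood _ _ hadj.symm hb).symm
    have := Finset.card_le_card hsub
    rw [Finset.card_union_of_disjoint hdisj,
      Finset.card_image_of_injective _ Prod.swap_injective] at this
    omega
  have hval : Γ.assignmentValue ψ ≤ Γ.value :=
    le_ciSup (f := Γ.assignmentValue) (Set.finite_range _).bddAbove ψ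
  have hdarts : (Γ.darts.card : ℝ) ≤ 2 * Γ.edges.card := by exact_mod_cast card_darts_le
  have hE : (0 : ℝ) < Γ.edges.card := by
    have : (0 : ℝ) < Γ.darts.card := Nat.cast_pos.2 Γ.card_darts_pos
    linarith
  have hsplit := Finset.card_filter_add_card_filter_not (s := Γ.edges)
    fun e => (ψ e.1, ψ e.2) ∈ Γ.constraint e.1 e.2
  have hsplit : ((Γ.edges.filter fun e => (ψ e.1, ψ e.2) ∈ Γ.constraint e.1 e.2).card : ℝ) +
      unsat.card = Γ.edges.card := by exact_mod_cast hsplit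
  have hlt := hval.trans_lt h
  rw [assignmentValue, div_lt_iff₀ hE] at hlt
  have h2 : (2 : ℝ) * unsat.card ≤ bad.card := by exact_mod_cast hunsatcard
  have h3 : ε * Γ.darts.card ≤ ε * (2 * Γ.edges.card) := mul_le_mul_of_nonneg_left hdarts hε.le
  linarith

end CSP

/-! ### Reading encoded inputs -/

/-- The bit of the word `w` at position `i`, as a number. -/
def bitAt (w : List Bool) (i : ℕ) : ℕ := (w.getD i false).toNat

/-- The length of the block of ones that starts at position `a` of `w`. -/
def countOnes (w : List Bool) (a : ℕ) : ℕ :=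
  ∑ j ∈ Finset.range w.length, (1 - ∑ i ∈ Finset.range (j + 1), (1 - bitAt w (a + i)))

theorem bitAt_append_right {l l' : List Bool} {a : ℕ} (h : l.length = a) (i : ℕ) :
    bitAt (l ++ l') (a + i) = bitAt l' i := by
  subst h
  rw [bitAt, List.getD_append_right _ _ _ _ (by omega), Nat.add_sub_cancel_left, bitAt]

theorem bitAt_append_left {l l' : List Bool} {i : ℕ} (h : i < l.length) :
    bitAt (l ++ l') i = bitAt l i := by
  rw [bitAt, List.getD_append _ _ _ _ h, bitAt]

theorem countOnes_eq (n : ℕ) {l l' : List Bool} {a : ℕ} (h : l.length = a) :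
    countOnes (l ++ (List.replicate n true ++ [false] ++ l')) a = n := by
  have hbit : ∀ i, i < n →
      bitAt (l ++ (List.replicate n true ++ [false] ++ l')) (a + i) = 1 := by
    intro i hi
    rw [bitAt_append_right h, List.append_assoc, bitAt_append_left (by simpa)]
    simp [bitAt, hi]
  have hzero : bitAt (l ++ (List.replicate n true ++ [false] ++ l')) (a + n) = 0 := by
    rw [bitAt_append_right h, List.append_assoc]
    have := bitAt_append_right (l := List.replicate n true) (l' := [false] ++ l') (a := n)
      (by simp) 0
    rw [add_zero] at this
    rw [this]
    simp [bitAt]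
  have hterm : ∀ j, 1 - ∑ i ∈ Finset.range (j + 1),
      (1 - bitAt (l ++ (List.replicate n true ++ [false] ++ l')) (a + i)) =
        if j < n then 1 else 0 := by
    intro j
    split_ifs with hj
    · rw [Finset.sum_eq_zero fun i hi => by rw [hbit i (by rw [Finset.mem_range] at hi; omega), Nat.sub_self], Nat.sub_zero]
    · have : 1 ≤ ∑ i ∈ Finset.range (j + 1),
          (1 - bitAt (l ++ (List.replicate n true ++ [false] ++ l')) (a + i)) := by
        refine le_trans ?_ (Finset.single_le_sum (fun _ _ => Nat.zero_le _)
          (Finset.mem_range.2 (show n < j + 1 by omega)))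
        rw [hzero]
      omega
  rw [countOnes, Finset.sum_congr rfl fun j _ => hterm j, ← Finset.card_filter]
  have hfilter : (Finset.range (l ++ (List.replicate n true ++ [false] ++ l')).length).filter
      (· < n) = Finset.range n := by
    ext j
    simp only [Finset.mem_filter, Finset.mem_range, List.length_append, List.length_replicate]
    omega
  rw [hfilter, Finset.card_range]

theorem length_flatMap_finRange {n B : ℕ} {f : Fin n → List Bool} (hf : ∀ i, (f i).length = B) :
    ((List.finRange n).flatMap f).length = n * B := by
  simp [List.length_flatMap, hf]

theorem bitAt_flatMap_finRange {n B : ℕ} {f : Fin n → List Bool} (hf : ∀ i, (f i).length = B)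
    (i : Fin n) {r : ℕ} (hr : r < B) :
    bitAt ((List.finRange n).flatMap f) (i * B + r) = bitAt (f i) r := by
  induction n with
  | zero => exact i.elim0
  | succ n ih =>
    rw [List.finRange_succ, List.flatMap_cons, List.flatMap_map]
    refine Fin.cases ?_ (fun i => ?_) i
    · rw [Fin.val_zero, zero_mul, zero_add, bitAt_append_left (by rwa [hf])]
    · rw [Fin.val_succ, show (i + 1 : ℕ) * B + r = B + (i * B + r) by ring,
        bitAt_append_right (hf 0), ih fun i => hf i.succ]

theorem bitAt_map_finRange {n : ℕ} (f : Fin n → Bool) (i : Fin n) :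
    bitAt ((List.finRange n).map f) i = (f i).toNat := by
  simp [bitAt]

theorem flatMap_range {β : Type} (n : ℕ) (g : ℕ → List β) :
    (List.range n).flatMap g = (List.finRange n).flatMap fun i : Fin n => g i := by
  rw [← List.map_coe_finRange_eq_range, List.flatMap_map]

/-! ### Arithmetic of bits -/

/-- The sum of two bits modulo two. -/
def natXor (a b : ℕ) : ℕ := (a - b) + (b - a)

/-- The bit that tells whether two numbers are equal. -/
def natEq (a b : ℕ) : ℕ := 1 - natXor a b

/-- The bit that tells whether the first number is smaller than the second. -/
def natLt (a b : ℕ) : ℕ := 1 - (1 - (b - a))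

theorem val_add_zmod_two (a b : ZMod 2) : (a + b).val = natXor a.val b.val := by
  revert a b; decide

theorem val_mul_zmod_two (a b : ZMod 2) : (a * b).val = a.val * b.val := by
  revert a b; decide

theorem val_ind {n : ℕ} (i j : Fin n) : (ind i j).val = natEq i j := by
  unfold ind natEq natXor
  split_ifs with h
  · subst h; simp; rfl
  · have : (i : ℕ) ≠ j := fun h' => h (Fin.ext h')
    rw [ZMod.val_zero]; omega

section

variable {α : Type} [Env α]

namespace Evaluable

theorem natXor {f g : List Bool → α → ℕ} (hf : Evaluable f) (hg : Evaluable g) :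
    Evaluable fun w x => natXor (f w x) (g w x) :=
  (hf.sub hg).add (hg.sub hf)

theorem natEq {f g : List Bool → α → ℕ} (hf : Evaluable f) (hg : Evaluable g) :
    Evaluable fun w x => natEq (f w x) (g w x) :=
  (lit 1).sub (hf.natXor hg)

theorem natLt {f g : List Bool → α → ℕ} (hf : Evaluable f) (hg : Evaluable g) :
    Evaluable fun w x => natLt (f w x) (g w x) :=
  (lit 1).sub ((lit 1).sub (hg.sub hf))

theorem bitAt {f : List Bool → α → ℕ} (hf : Evaluable f) :
    Evaluable fun w x => bitAt w (f w x) :=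
  hf.bit

theorem countOnes {f : List Bool → α → ℕ} (hf : Evaluable f) :
    Evaluable fun w x => countOnes w (f w x) :=
  length.sum (g := fun w x j => 1 - ∑ i ∈ Finset.range (j + 1), (1 - FPT.bitAt w (f w x + i)))
    ((lit 1).sub (sum (f := fun _ (y : α × ℕ) => y.2 + 1)
      (g := fun w y i => 1 - FPT.bitAt w (f w y.1 + i)) (last.add (lit 1))
      ((lit 1).sub (hf.weaken.weaken.add last).bitAt)))

end Evaluable

theorem Emittable.ones {f : List Bool → α → ℕ} (hf : Evaluable f) :
    Emittable fun w x => List.replicate (f w x) 1 := by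
  have h := Emittable.flatMap (g := fun _ _ _ => [1]) hf (Emittable.singleton (Evaluable.lit 1))
  convert h using 2
  funext x
  rw [List.flatMap_def]
  simp

end

/-! ### Writing linear systems -/

section

variable {β : Type}

theorem flatMap_enumList_fin {n : ℕ} (g : Fin n → List β) :
    (enumList (Fin n)).flatMap g = (List.finRange n).flatMap g := by
  rw [enumList_fin]

theorem flatMap_enumList_prod {α α' : Type} [Enumerated α] [Enumerated α']
    (g : α × α' → List β) : (enumList (α × α')).flatMap g =
      (enumList α).flatMap fun a => (enumList α').flatMap fun b => g (a, b) := by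
  rw [enumList_prod, List.flatMap_assoc]
  simp only [List.flatMap_map]

theorem flatMap_enumList_sum {α α' : Type} [Enumerated α] [Enumerated α']
    (g : α ⊕ α' → List β) : (enumList (α ⊕ α')).flatMap g =
      (enumList α).flatMap (fun a => g (.inl a)) ++ (enumList α').flatMap fun b => g (.inr b) := by
  rw [enumList_sum, List.flatMap_append, List.flatMap_map, List.flatMap_map]

end

theorem card_enumerated_fin (n : ℕ) : Enumerated.card (Fin n) = n := rfl

theorem card_enumerated_prod (α β : Type) [Enumerated α] [Enumerated β] :
    Enumerated.card (α × β) = Enumerated.card α * Enumerated.card β := rfl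

theorem card_enumerated_sum (α β : Type) [Enumerated α] [Enumerated β] :
    Enumerated.card (α ⊕ β) = Enumerated.card α + Enumerated.card β := rfl

/-! ### The squaring reduction in polynomial time -/

namespace MLD

/-- The number of rows, read off the encoding of a decoding instance. -/
def readRows (w : List Bool) : ℕ := countOnes w 0

/-- The number of columns, read off the encoding. -/
def readCols (w : List Bool) : ℕ := countOnes w (readRows w + 1)

/-- The parameter, read off the encoding. -/
def readParam (w : List Bool) : ℕ := countOnes w (readRows w + 1 + readCols w + 1)

/-- The position of the matrix in the encoding. -/
def matrixStart (w : List Bool) : ℕ := readRows w + 1 + readCols w + 1 + readParam w + 1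

/-- An entry of the matrix, read off the encoding. -/
def readMatrix (w : List Bool) (i j : ℕ) : ℕ := bitAt w (matrixStart w + (i * readCols w + j))

/-- An entry of the vector, read off the encoding. -/
def readVector (w : List Bool) (i : ℕ) : ℕ :=
  bitAt w (matrixStart w + (readRows w * readCols w + i))

variable (I : MLD)

theorem readRows_encode : readRows I.encode = I.n := by
  have := countOnes_eq I.n (l := []) (a := 0) rfl (l' := List.replicate I.m true ++ [false] ++
    List.replicate I.k true ++ [false] ++
    ((List.finRange I.n).flatMap fun i => (List.finRange I.m).map fun j => decide (I.A i j = 1)) ++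
    ((List.finRange I.n).map fun i => decide (I.y i = 1)))
  simpa only [readRows, encode, List.append_assoc, List.nil_append] using this

theorem readCols_encode : readCols I.encode = I.m := by
  have := countOnes_eq I.m (l := List.replicate I.n true ++ [false]) (a := I.n + 1) (by simp)
    (l' := List.replicate I.k true ++ [false] ++
    ((List.finRange I.n).flatMap fun i => (List.finRange I.m).map fun j => decide (I.A i j = 1)) ++
    ((List.finRange I.n).map fun i => decide (I.y i = 1)))
  rw [readCols, readRows_encode]
  simpa only [encode, List.append_assoc] using this

theorem readParam_encode : readParam I.encode = I.k := by
  have := countOnes_eq I.k (l := List.replicate I.n true ++ [false] ++ List.replicate I.m true ++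
    [false]) (a := I.n + 1 + I.m + 1) (by simp; omega)
    (l' := ((List.finRange I.n).flatMap fun i =>
      (List.finRange I.m).map fun j => decide (I.A i j = 1)) ++
    ((List.finRange I.n).map fun i => decide (I.y i = 1)))
  rw [readParam, readRows_encode, readCols_encode]
  simpa only [encode, List.append_assoc] using this

theorem matrixStart_encode : matrixStart I.encode =
    (List.replicate I.n true ++ [false] ++ List.replicate I.m true ++ [false] ++
      List.replicate I.k true ++ [false]).length := by
  rw [matrixStart, readRows_encode, readCols_encode, readParam_encode]
  simp
  omega

theorem readMatrix_encode (i : Fin I.n) (j : Fin I.m) :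
    readMatrix I.encode i j = (I.A i j).val := by
  have hlen : ∀ i : Fin I.n, ((List.finRange I.m).map fun j => decide (I.A i j = 1)).length =
    I.m := by simp
  rw [readMatrix, readCols_encode, matrixStart_encode, encode, List.append_assoc,
    bitAt_append_right rfl, bitAt_append_left,
    bitAt_flatMap_finRange hlen i j.2, bitAt_map_finRange, toNat_decide_eq_one]
  rw [length_flatMap_finRange hlen]
  have := Nat.mul_le_mul_right I.m (Nat.succ_le_of_lt i.2)
  rw [Nat.succ_mul] at this
  have := j.2
  omega

theorem readVector_encode (i : Fin I.n) : readVector I.encode i = (I.y i).val := by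
  rw [readVector, readRows_encode, readCols_encode, matrixStart_encode, encode, List.append_assoc,
    bitAt_append_right rfl,
    bitAt_append_right (length_flatMap_finRange (by simp)), bitAt_map_finRange,
    toNat_decide_eq_one]

section

variable {α : Type} [Env α]

theorem evaluable_readRows : Evaluable fun w (_ : α) => readRows w :=
  (Evaluable.lit 0).countOnes

theorem evaluable_readCols : Evaluable fun w (_ : α) => readCols w :=
  (evaluable_readRows.add (.lit 1)).countOnes

theorem evaluable_readParam : Evaluable fun w (_ : α) => readParam w :=
  (((evaluable_readRows.add (.lit 1)).add evaluable_readCols).add (.lit 1)).countOnes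

theorem evaluable_matrixStart : Evaluable fun w (_ : α) => matrixStart w :=
  ((((evaluable_readRows.add (.lit 1)).add evaluable_readCols).add (.lit 1)).add
    evaluable_readParam).add (.lit 1)

theorem evaluable_readMatrix {f g : List Bool → α → ℕ} (hf : Evaluable f) (hg : Evaluable g) :
    Evaluable fun w x => readMatrix w (f w x) (g w x) :=
  (evaluable_matrixStart.add ((hf.mul evaluable_readCols).add hg)).bitAt

theorem evaluable_readVector {f : List Bool → α → ℕ} (hf : Evaluable f) :
    Evaluable fun w x => readVector w (f w x) :=
  (evaluable_matrixStart.add ((evaluable_readRows.mul evaluable_readCols).add hf)).bitAt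

end

/-- The encoding of the squared instance, in terms of the encoding of the instance. -/
def squareWord (w : List Bool) (_ : Unit) : List ℕ :=
  List.replicate (readCols w * (readRows w * readRows w) + readRows w * readRows w) 1 ++ [0] ++
  List.replicate (readCols w * readCols w) 1 ++ [0] ++
  List.replicate (readParam w * readParam w) 1 ++ [0] ++
  (((List.range (readCols w)).flatMap fun j => (List.range (readRows w)).flatMap fun i =>
      (List.range (readRows w)).flatMap fun i' => (List.range (readCols w)).flatMap fun j' =>
        (List.range (readCols w)).flatMap fun l =>
          [natEq j j' * natXor (readVector w i * readMatrix w i' l)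
            (readVector w i' * readMatrix w i l)]) ++
    (List.range (readRows w)).flatMap fun r => (List.range (readRows w)).flatMap fun i =>
      (List.range (readCols w)).flatMap fun j => (List.range (readCols w)).flatMap fun l =>
        [readMatrix w r j * readMatrix w i l]) ++
  (((List.range (readCols w)).flatMap fun _ => (List.range (readRows w)).flatMap fun _ =>
      (List.range (readRows w)).flatMap fun _ => [0]) ++
    (List.range (readRows w)).flatMap fun r => (List.range (readRows w)).flatMap fun i =>
      [readVector w r * readVector w i])

theorem squareWord_encode : squareWord I.encode () = I.square.encode.map Bool.toNat := by
  rw [square, encode_ofSystem]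
  simp only [squareWord, readRows_encode, readCols_encode, readParam_encode,
    List.map_eq_flatMap, flatMap_enumList_sum, flatMap_enumList_prod, flatMap_enumList_fin,
    flatMap_range, squareMatrix, squareVector, val_add_zmod_two, val_mul_zmod_two, val_ind,
    readMatrix_encode, readVector_encode, card_enumerated_fin, card_enumerated_prod,
    card_enumerated_sum, ZMod.val_zero]

theorem emittable_squareWord : Emittable squareWord := by
  have hR {α : Type} [Env α] := evaluable_readRows (α := α)
  have hC {α : Type} [Env α] := evaluable_readCols (α := α)
  have hK {α : Type} [Env α] := evaluable_readParam (α := α)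
  refine .append (.append (.append (.append (.append (.append (.append (.ones ?_) (.singleton ?_))
    (.ones ?_)) (.singleton ?_)) (.ones ?_)) (.singleton ?_)) (.append
      (.flatMap hC (.flatMap hR (.flatMap hR (.flatMap hC (.flatMap hC (.singleton ?_))))))
      (.flatMap hR (.flatMap hR (.flatMap hC (.flatMap hC (.singleton ?_)))))))
    (.append (.flatMap hC (.flatMap hR (.flatMap hR (.singleton ?_))))
      (.flatMap hR (.flatMap hR (.singleton ?_))))
  · exact (hC.mul (hR.mul hR)).add (hR.mul hR)
  · exact .lit 0
  · exact hC.mul hC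
  · exact .lit 0
  · exact hK.mul hK
  · exact .lit 0
  · exact (Evaluable.last.weaken.weaken.weaken.weaken.natEq Evaluable.last.weaken).mul
      (((evaluable_readVector Evaluable.last.weaken.weaken.weaken).mul
        (evaluable_readMatrix Evaluable.last.weaken.weaken Evaluable.last)).natXor
      ((evaluable_readVector Evaluable.last.weaken.weaken).mul
        (evaluable_readMatrix Evaluable.last.weaken.weaken.weaken Evaluable.last)))
  · exact (evaluable_readMatrix Evaluable.last.weaken.weaken.weaken Evaluable.last.weaken).mul
      (evaluable_readMatrix Evaluable.last.weaken.weaken Evaluable.last)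
  · exact .lit 0
  · exact (evaluable_readVector Evaluable.last.weaken).mul (evaluable_readVector Evaluable.last)

end MLD

theorem exists_algorithm_gapMLD_of_sq {γ : ℝ} {hγ : 1 ≤ γ} {hγ' : 1 ≤ γ ^ 2}
    (h : ∃ p, IsRandomizedFPTAlgorithm (gapMLD (γ ^ 2) hγ') p) :
    ∃ p, IsRandomizedFPTAlgorithm (gapMLD γ hγ) p := by
  refine exists_algorithm_of_reduction (P := gapMLD γ hγ) (Q := gapMLD (γ ^ 2) hγ') MLD.square
    MLD.emittable_squareWord MLD.squareWord_encode (fun I => ?_) (fun I => ?_)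
    (fun I hI => MLD.square_mem_yes hI) (fun I hI => MLD.square_mem_no hI) h
  · change 2 ≤ I.encode.length
    simp only [MLD.encode, List.length_append, List.length_singleton]
    omega
  · exact (sq I.k).ge

/-! ### The reduction from 2CSP in polynomial time -/

namespace CSP

/-- The number of variables, read off the encoding of a 2CSP instance. -/
def readVars (w : List Bool) : ℕ := countOnes w 0

/-- The size of the alphabet, read off the encoding. -/
def readAlphabet (w : List Bool) : ℕ := countOnes w (readVars w + 1)

/-- The position of the adjacency matrix in the encoding. -/
def adjStart (w : List Bool) : ℕ := readVars w + 1 + readAlphabet w + 1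

/-- The adjacency of two vertices, read off the encoding. -/
def readAdj (w : List Bool) (u v : ℕ) : ℕ := bitAt w (adjStart w + (u * readVars w + v))

/-- An entry of the truth table of a constraint, read off the encoding. -/
def readConstraint (w : List Bool) (u v s t : ℕ) : ℕ :=
  bitAt w (adjStart w + (readVars w * readVars w +
    (u * (readVars w * (readAlphabet w * readAlphabet w)) +
      (v * (readAlphabet w * readAlphabet w) + (s * readAlphabet w + t)))))

/-- The bit that tells whether a pair of labels is allowed on a pair of vertices. -/
def readAllowed (w : List Bool) (u v s t : ℕ) : ℕ :=
  readAdj w u v * (natLt u v * readConstraint w u v s t +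
    (1 - natLt u v) * readConstraint w v u t s)

/-- The number of ordered pairs of adjacent vertices, read off the encoding. -/
def readDarts (w : List Bool) : ℕ :=
  ∑ u ∈ Finset.range (readVars w), ∑ v ∈ Finset.range (readVars w), readAdj w u v

variable (Γ : CSP)

theorem readVars_encode : readVars Γ.encode = Γ.n := by
  classical
  have := countOnes_eq Γ.n (l := []) (a := 0) rfl (l' := List.replicate Γ.q true ++ [false] ++
    ((List.finRange Γ.n).flatMap fun u => (List.finRange Γ.n).map fun v =>
      decide (Γ.graph.Adj u v)) ++
    ((List.finRange Γ.n).flatMap fun u => (List.finRange Γ.n).flatMap fun v =>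
      (List.finRange Γ.q).flatMap fun a => (List.finRange Γ.q).map fun b =>
        decide ((a, b) ∈ Γ.constraint u v)))
  rw [readVars, encode]
  convert this using 2
  simp only [List.append_assoc, List.nil_append]

theorem readAlphabet_encode : readAlphabet Γ.encode = Γ.q := by
  classical
  have := countOnes_eq Γ.q (l := List.replicate Γ.n true ++ [false]) (a := Γ.n + 1) (by simp)
    (l' := ((List.finRange Γ.n).flatMap fun u => (List.finRange Γ.n).map fun v =>
      decide (Γ.graph.Adj u v)) ++
    ((List.finRange Γ.n).flatMap fun u => (List.finRange Γ.n).flatMap fun v =>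
      (List.finRange Γ.q).flatMap fun a => (List.finRange Γ.q).map fun b =>
        decide ((a, b) ∈ Γ.constraint u v)))
  rw [readAlphabet, readVars_encode, encode]
  convert this using 2
  simp only [List.append_assoc]

theorem adjStart_encode : adjStart Γ.encode =
    (List.replicate Γ.n true ++ [false] ++ List.replicate Γ.q true ++ [false]).length := by
  rw [adjStart, readVars_encode, readAlphabet_encode]
  simp
  omega

theorem index_lt {n B i r : ℕ} (hi : i < n) (hr : r < B) : i * B + r < n * B := by
  have := Nat.mul_le_mul_right B (Nat.succ_le_of_lt hi)
  rw [Nat.succ_mul] at this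
  omega

theorem readAdj_encode (u v : Fin Γ.n) : readAdj Γ.encode u v = (Γ.adjInd u v).val := by
  classical
  rw [readAdj, readVars_encode, adjStart_encode, encode, List.append_assoc, bitAt_append_right rfl,
    bitAt_append_left, bitAt_flatMap_finRange (by simp) u v.2, bitAt_map_finRange, adjInd]
  · by_cases h : Γ.graph.Adj u v
    · simp [h]; rfl
    · simp [h]
  · rw [length_flatMap_finRange (B := Γ.n) (by simp)]
    exact index_lt u.2 v.2

open Classical in
theorem readConstraint_encode (u v : Fin Γ.n) (s t : Fin Γ.q) :
    readConstraint Γ.encode u v s t = if (s, t) ∈ Γ.constraint u v then 1 else 0 := by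
  have h1 : ∀ (u v : Fin Γ.n) (a : Fin Γ.q), ((List.finRange Γ.q).map fun b =>
      decide ((a, b) ∈ Γ.constraint u v)).length = Γ.q := by simp
  have h2 : ∀ u v : Fin Γ.n, ((List.finRange Γ.q).flatMap fun a => (List.finRange Γ.q).map fun b =>
      decide ((a, b) ∈ Γ.constraint u v)).length = Γ.q * Γ.q :=
    fun u v => length_flatMap_finRange (h1 u v)
  have h3 : ∀ u : Fin Γ.n, ((List.finRange Γ.n).flatMap fun v =>
      (List.finRange Γ.q).flatMap fun a => (List.finRange Γ.q).map fun b =>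
        decide ((a, b) ∈ Γ.constraint u v)).length = Γ.n * (Γ.q * Γ.q) :=
    fun u => length_flatMap_finRange (h2 u)
  rw [readConstraint, readVars_encode, readAlphabet_encode, adjStart_encode, encode,
    List.append_assoc, bitAt_append_right rfl,
    bitAt_append_right (length_flatMap_finRange (by simp)),
    bitAt_flatMap_finRange h3 u (index_lt v.2 (index_lt s.2 t.2)),
    bitAt_flatMap_finRange (h2 u) v (index_lt s.2 t.2),
    bitAt_flatMap_finRange (h1 u v) s t.2, bitAt_map_finRange]
  split_ifs with h <;> simp [h]

theorem readAllowed_encode (u v : Fin Γ.n) (s t : Fin Γ.q) :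
    readAllowed Γ.encode u v s t = (Γ.allowedInd u v s t).val := by
  classical
  rw [readAllowed, readAdj_encode, readConstraint_encode, readConstraint_encode, adjInd,
    allowedInd]
  unfold Allowed natLt
  by_cases h : Γ.graph.Adj u v
  · have h1 : (1 : ZMod 2).val = 1 := rfl
    by_cases huv : u < v
    · have : (u : ℕ) < v := huv
      rw [show 1 - (1 - ((v : ℕ) - u)) = 1 by omega]
      by_cases hc : (s, t) ∈ Γ.constraint u v <;> simp [h, huv, hc, h1]
    · have : ¬ (u : ℕ) < v := huv
      rw [show 1 - (1 - ((v : ℕ) - u)) = 0 by omega]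
      by_cases hc : (t, s) ∈ Γ.constraint v u <;> simp [h, huv, hc, h1]
  · simp [h]

theorem readDarts_encode : readDarts Γ.encode = Γ.darts.card := by
  classical
  rw [readDarts, readVars_encode, darts, Finset.card_filter, Fintype.sum_prod_type,
    Finset.sum_range]
  refine Finset.sum_congr rfl fun u _ => ?_
  rw [Finset.sum_range]
  refine Finset.sum_congr rfl fun v _ => ?_
  rw [readAdj_encode, adjInd]
  split_ifs <;> rfl

section

variable {α : Type} [Env α]

theorem evaluable_readVars : Evaluable fun w (_ : α) => readVars w :=
  (Evaluable.lit 0).countOnes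

theorem evaluable_readAlphabet : Evaluable fun w (_ : α) => readAlphabet w :=
  (evaluable_readVars.add (.lit 1)).countOnes

theorem evaluable_adjStart : Evaluable fun w (_ : α) => adjStart w :=
  ((evaluable_readVars.add (.lit 1)).add evaluable_readAlphabet).add (.lit 1)

theorem evaluable_readAdj {f g : List Bool → α → ℕ} (hf : Evaluable f) (hg : Evaluable g) :
    Evaluable fun w x => readAdj w (f w x) (g w x) :=
  (evaluable_adjStart.add ((hf.mul evaluable_readVars).add hg)).bitAt

theorem evaluable_readConstraint {f g h k : List Bool → α → ℕ} (hf : Evaluable f)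
    (hg : Evaluable g) (hh : Evaluable h) (hk : Evaluable k) :
    Evaluable fun w x => readConstraint w (f w x) (g w x) (h w x) (k w x) :=
  (evaluable_adjStart.add ((evaluable_readVars.mul evaluable_readVars).add
    ((hf.mul (evaluable_readVars.mul (evaluable_readAlphabet.mul evaluable_readAlphabet))).add
      ((hg.mul (evaluable_readAlphabet.mul evaluable_readAlphabet)).add
        ((hh.mul evaluable_readAlphabet).add hk))))).bitAt

theorem evaluable_readAllowed {f g h k : List Bool → α → ℕ} (hf : Evaluable f)
    (hg : Evaluable g) (hh : Evaluable h) (hk : Evaluable k) :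
    Evaluable fun w x => readAllowed w (f w x) (g w x) (h w x) (k w x) :=
  (evaluable_readAdj hf hg).mul (((hf.natLt hg).mul (evaluable_readConstraint hf hg hh hk)).add
    (((Evaluable.lit 1).sub (hf.natLt hg)).mul (evaluable_readConstraint hg hf hk hh)))

theorem evaluable_readDarts : Evaluable fun w (_ : α) => readDarts w :=
  evaluable_readVars.sum (g := fun w _ u => ∑ v ∈ Finset.range (readVars w), readAdj w u v)
    (evaluable_readVars.sum (g := fun w (y : α × ℕ) v => readAdj w y.2 v)
      (evaluable_readAdj Evaluable.last.weaken Evaluable.last))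

end

/-- The encoding of the decoding instance, in terms of the encoding of the 2CSP instance. -/
def toMLDWord (w : List Bool) (_ : Unit) : List ℕ :=
  List.replicate (readVars w * (readVars w * (readAlphabet w * readAlphabet w)) +
    (readVars w * readVars w + readVars w * (readVars w * (readVars w * readAlphabet w)))) 1 ++
  [0] ++
  List.replicate (readVars w * (readVars w * (readAlphabet w * readAlphabet w))) 1 ++ [0] ++
  List.replicate (readDarts w) 1 ++ [0] ++
  (((List.range (readVars w)).flatMap fun u => (List.range (readVars w)).flatMap fun v =>
      (List.range (readAlphabet w)).flatMap fun s => (List.range (readAlphabet w)).flatMap fun t =>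
      (List.range (readVars w)).flatMap fun a => (List.range (readVars w)).flatMap fun b =>
      (List.range (readAlphabet w)).flatMap fun c => (List.range (readAlphabet w)).flatMap fun d =>
        [natXor (natEq u a * natEq v b * natEq s c * natEq t d)
          (readAllowed w u v s t * (natEq u b * natEq v a * natEq s d * natEq t c))]) ++
    (((List.range (readVars w)).flatMap fun u => (List.range (readVars w)).flatMap fun v =>
      (List.range (readVars w)).flatMap fun a => (List.range (readVars w)).flatMap fun b =>
      (List.range (readAlphabet w)).flatMap fun _ => (List.range (readAlphabet w)).flatMap fun _ =>
        [natEq u a * natEq v b]) ++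
    ((List.range (readVars w)).flatMap fun u => (List.range (readVars w)).flatMap fun v =>
      (List.range (readVars w)).flatMap fun v' => (List.range (readAlphabet w)).flatMap fun s =>
      (List.range (readVars w)).flatMap fun a => (List.range (readVars w)).flatMap fun b =>
      (List.range (readAlphabet w)).flatMap fun c => (List.range (readAlphabet w)).flatMap fun _ =>
        [readAdj w u v * readAdj w u v' * (natEq u a * natEq s c) *
          natXor (natEq v b) (natEq v' b)]))) ++
  (((List.range (readVars w)).flatMap fun _ => (List.range (readVars w)).flatMap fun _ =>
      (List.range (readAlphabet w)).flatMap fun _ => (List.range (readAlphabet w)).flatMap fun _ =>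
        [0]) ++
    (((List.range (readVars w)).flatMap fun u => (List.range (readVars w)).flatMap fun v =>
        [readAdj w u v]) ++
    ((List.range (readVars w)).flatMap fun _ => (List.range (readVars w)).flatMap fun _ =>
      (List.range (readVars w)).flatMap fun _ => (List.range (readAlphabet w)).flatMap fun _ =>
        [0])))

theorem toMLDWord_encode : toMLDWord Γ.encode () = Γ.toMLD.encode.map Bool.toNat := by
  rw [toMLD, MLD.encode_ofSystem]
  simp only [toMLDWord, readVars_encode, readAlphabet_encode, readDarts_encode,
    List.map_eq_flatMap, flatMap_enumList_sum, flatMap_enumList_prod, flatMap_enumList_fin,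
    flatMap_range, systemMatrix, systemVector, val_add_zmod_two, val_mul_zmod_two, val_ind,
    readAdj_encode, readAllowed_encode, card_enumerated_fin, card_enumerated_prod,
    card_enumerated_sum, ZMod.val_zero]

theorem emittable_toMLDWord : Emittable toMLDWord := by
  have hV {α : Type} [Env α] := evaluable_readVars (α := α)
  have hA {α : Type} [Env α] := evaluable_readAlphabet (α := α)
  have x0 {α : Type} [Env α] := Evaluable.last (α := α)
  have x1 {α : Type} [Env α] := (x0 (α := α)).weaken
  have x2 {α : Type} [Env α] := (x1 (α := α)).weaken
  have x3 {α : Type} [Env α] := (x2 (α := α)).weaken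
  have x4 {α : Type} [Env α] := (x3 (α := α)).weaken
  have x5 {α : Type} [Env α] := (x4 (α := α)).weaken
  have x6 {α : Type} [Env α] := (x5 (α := α)).weaken
  have x7 {α : Type} [Env α] := (x6 (α := α)).weaken
  refine .append (.append (.append (.append (.append (.append (.append (.ones ?_) (.singleton ?_))
    (.ones ?_)) (.singleton ?_)) (.ones ?_)) (.singleton ?_))
    (.append
      (.flatMap hV (.flatMap hV (.flatMap hA (.flatMap hA
        (.flatMap hV (.flatMap hV (.flatMap hA (.flatMap hA (.singleton ?_)))))))))
      (.append
        (.flatMap hV (.flatMap hV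
          (.flatMap hV (.flatMap hV (.flatMap hA (.flatMap hA (.singleton ?_)))))))
        (.flatMap hV (.flatMap hV (.flatMap hV (.flatMap hA
          (.flatMap hV (.flatMap hV (.flatMap hA (.flatMap hA (.singleton ?_))))))))))))
    (.append (.flatMap hV (.flatMap hV (.flatMap hA (.flatMap hA (.singleton ?_)))))
      (.append (.flatMap hV (.flatMap hV (.singleton ?_)))
        (.flatMap hV (.flatMap hV (.flatMap hV (.flatMap hA (.singleton ?_)))))))
  · exact (hV.mul (hV.mul (hA.mul hA))).add ((hV.mul hV).add (hV.mul (hV.mul (hV.mul hA))))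
  · exact .lit 0
  · exact hV.mul (hV.mul (hA.mul hA))
  · exact .lit 0
  · exact evaluable_readDarts
  · exact .lit 0
  · exact ((((x7.natEq x3).mul (x6.natEq x2)).mul (x5.natEq x1)).mul (x4.natEq x0)).natXor
      ((evaluable_readAllowed x7 x6 x5 x4).mul
        ((((x7.natEq x2).mul (x6.natEq x3)).mul (x5.natEq x0)).mul (x4.natEq x1)))
  · exact (x5.natEq x3).mul (x4.natEq x2)
  · exact (((evaluable_readAdj x7 x6).mul (evaluable_readAdj x7 x5)).mul
      ((x7.natEq x3).mul (x4.natEq x1))).mul ((x6.natEq x2).natXor (x5.natEq x2))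
  · exact .lit 0
  · exact evaluable_readAdj x1 x0
  · exact .lit 0

end CSP

theorem exists_algorithm_gapCSP_of_gapMLD {ε : ℝ} (hε : 0 < ε) {hγ : 1 ≤ 1 + ε}
    (h : ∃ p, IsRandomizedFPTAlgorithm (gapMLD (1 + ε) hγ) p) :
    ∃ p, IsRandomizedFPTAlgorithm (gapCSP ε hε.le) p := by
  refine exists_algorithm_of_reduction (P := gapCSP ε hε.le) (Q := gapMLD (1 + ε) hγ) CSP.toMLD
    CSP.emittable_toMLDWord CSP.toMLDWord_encode (fun Γ => ?_) (fun Γ => ?_)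
    (fun Γ hΓ => CSP.toMLD_mem_yes hΓ) (fun Γ hΓ => CSP.toMLD_mem_no hε hΓ) h
  · change 2 ≤ Γ.encode.length
    simp only [CSP.encode, List.length_append, List.length_singleton]
    omega
  · change Γ.darts.card ≤ Γ.n ^ 2
    refine (Finset.card_le_univ _).trans_eq ?_
    rw [Fintype.card_prod, Fintype.card_fin, sq]

/-! ### Amplification of the gap -/

theorem IsRandomizedFPTAlgorithm.mono_gap {γ γ' : ℝ} {hγ : 1 ≤ γ} {hγ' : 1 ≤ γ'} (h : γ ≤ γ')
    {p : Prog} (hp : IsRandomizedFPTAlgorithm (gapMLD γ hγ) p) :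
    IsRandomizedFPTAlgorithm (gapMLD γ' hγ') p :=
  ⟨hp.1, hp.2.1, fun I hI => hp.2.2 I fun x hx =>
    hI x (hx.trans (mul_le_mul_of_nonneg_right h (Nat.cast_nonneg _)))⟩

theorem exists_algorithm_gapMLD_of_pow {γ : ℝ} (hγ : 1 ≤ γ) (r : ℕ) :
    ∀ {hγ' : 1 ≤ γ ^ 2 ^ r}, (∃ p, IsRandomizedFPTAlgorithm (gapMLD (γ ^ 2 ^ r) hγ') p) →
      ∃ p, IsRandomizedFPTAlgorithm (gapMLD γ hγ) p := by
  induction r with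
  | zero =>
    intro hγ' h
    simpa using h
  | succ r ih =>
    intro hγ' h
    refine ih (hγ' := one_le_pow₀ hγ) (exists_algorithm_gapMLD_of_sq (hγ' := ?_) ?_)
    · exact one_le_pow₀ (one_le_pow₀ hγ)
    · simpa only [pow_succ, pow_mul, pow_one] using h

end FPT

theorem theorem4p1 (hPIH : FPT.PIH) (γ : ℝ) (hγ : 1 ≤ γ) :
    ¬ ∃ p : FPT.Prog, FPT.IsRandomizedFPTAlgorithm (FPT.gapMLD γ hγ) p := by
  rintro ⟨p, hp⟩
  obtain ⟨ε, hε, hno⟩ := hPIH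
  have h1 : 1 ≤ 1 + ε := by linarith
  obtain ⟨r, hr⟩ := pow_unbounded_of_one_lt γ (by linarith : 1 < 1 + ε)
  have hle : γ ≤ (1 + ε) ^ 2 ^ r :=
    hr.le.trans (pow_le_pow_right₀ h1 Nat.lt_two_pow_self.le)
  exact hno (FPT.exists_algorithm_gapCSP_of_gapMLD hε (hγ := h1)
    (FPT.exists_algorithm_gapMLD_of_pow h1 r (hγ' := one_le_pow₀ h1) ⟨p, hp.mono_gap hle⟩))
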